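/- Let $R$ be an associative ring with identity. Modules are left $R$-modules unless stated otherwise, and complexes are $\mathbb{Z}$-indexed cochain complexes of modules. Definitions. * A sequence $0\to A\to B\to C\to 0$ of modules is *pure exact* if it is exact and stays exact under $M\otimes_R-$ for every right $R$-module $M$; then $A\to B$ is *pure monic* and $B\to C$ is *pure epic*. A module is *pure projective* (resp. *pure injective*) if it is projective (resp. injective) with respect to all pure exact sequences. * A complex $X$ is *pure exact at* $k$ if each of $d_X^{k-1}$ and $d_X^{k}$ is a pure epic followed by a pure monic and $0\to\operatorname{Ker} d_X^{k}\to X^k\to\operatorname{Coker} d_X^{k-1}\to 0$ is pure exact. It is *pure exact* if this holds for all $k\in\mathbb{Z}$. In the extended integers put $\inf_p X=\inf\{k\in\mathbb{Z} : X \text{ is not pure exact at } k\}$ and $\sup_p X=\sup\{k\in\mathbb{Z} : X \text{ is not pure exact at } k\}$, so that $\inf_pX=\infty$ and $\sup_pX=-\infty$ if $X$ is pure exact. * A cochain map is a *pure quasi-isomorphism* if its mapping cone is pure exact. $\mathbf{D}^b_{pur}(R)$ is the quotient of the bounded homotopy category $\mathbf{K}^b(R)$ by the pure exact bounded complexes;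 its objects are the bounded complexes. * For complexes $X,Y$, $\operatorname{Hom}_R(X,Y)$ is the total Hom complex, with $\prod_{j}\operatorname{Hom}_R(X^j,Y^{j+k})$ in degree $k$. A *pure projective resolution* of $X$ is a pure quasi-isomorphism $P\to X$ with all $P^i$ pure projective and such that $\operatorname{Hom}_R(P,-)$ sends pure exact complexes to pure exact complexes of $\mathbb{Z}$-modules. A *pure injective resolution* of $Y$ is a pure quasi-isomorphism $Y\to I$ with all $I^i$ pure injective and such that $\operatorname{Hom}_R(-,I)$ sends pure exact complexes to pure exact complexes of $\mathbb{Z}$-modules. * $\operatorname{ppd}X$ is the infimum, in the extended integers, of the $m\in\mathbb{Z}$ for which $X$ has a pure projective resolution $P\to X$ with $P^i=0$ for all $i<-m$; $\operatorname{pid}Y$ is the infimum of the $m\in\mathbb{Z}$ for which $Y$ has a pure injective resolution $Y\to I$ with $I^i=0$ for all $i>m$. * For bounded $X,Y$ and $i\in\mathbb{Z}$, $\operatorname{Pext}^i_R(X,Y)=H^i\operatorname{Hom}_R(P,Y)$, where $P\to X$ is any pure projective resolution. * The *left pure global dimension* of $R$ is the supremum of $\operatorname{ppd}M$ over all left $R$-modules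 $M$, regarded as complexes concentrated in degree $0$. Theorem. For every $n\in\mathbb{Z}$ the following statements are equivalent: 1. the left pure global dimension of $R$ is at most $n$; 2. $\operatorname{ppd} X\le n-\inf_p X$ for all $X\in\mathbf{D}^b_{pur}(R)$; 3. $\operatorname{pid} Y\le n+\sup_p Y$ for all $Y\in\mathbf{D}^b_{pur}(R)$; 4. $\operatorname{Pext}^i_R(X,Y)=0$ for all $X,Y\in\mathbf{D}^b_{pur}(R)$ and all integers $i>n+\sup_p Y-\inf_p X$. -/

import Mathlib

open CategoryTheory CategoryTheory.Limits
open scoped TensorProduct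

universe u v

noncomputable section

namespace PureDerived


section Tensor

variable {R : Type v} [Ring R] (M : Type u) [AddCommGroup M] [Module Rᵐᵒᵖ M]

/-- The subgroup of `M ⊗_ℤ A` generated by the elements `(m r) ⊗ a - m ⊗ (r a)`, for a right
`R`-module `M` and a left `R`-module `A`. -/
def balancing (A : Type u) [AddCommGroup A] [Module R A] : AddSubgroup (M ⊗[ℤ] A) :=
  AddSubgroup.closure {x | ∃ (m : M) (r : R) (a : A),
    x = (MulOpposite.op r • m) ⊗ₜ[ℤ] a - m ⊗ₜ[ℤ] (r • a)}

/-- The abelian group `M ⊗_R A` for a right `R`-module `M` and a left `R`-module `A` over a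
not necessarily commutative ring `R`. -/
abbrev RTensor (A : Type u) [AddCommGroup A] [Module R A] : Type u :=
  (M ⊗[ℤ] A) ⧸ balancing (R := R) M A

variable {A B : Type u} [AddCommGroup A] [Module R A] [AddCommGroup B] [Module R B]

theorem balancing_le_comap (f : A →ₗ[R] B) :
    balancing (R := R) M A ≤ (balancing (R := R) M B).comap
      (LinearMap.lTensor M f.toAddMonoidHom.toIntLinearMap).toAddMonoidHom := by
  refine (AddSubgroup.closure_le _).2 ?_
  rintro _ ⟨m, r, a, rfl⟩
  refine AddSubgroup.subset_closure ⟨m, r, f a, ?_⟩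
  simp

/-- The homomorphism `M ⊗_R f : M ⊗_R A → M ⊗_R B`. -/
def RTensor.map (f : A →ₗ[R] B) : RTensor (R := R) M A →+ RTensor (R := R) M B :=
  QuotientAddGroup.map _ _ (LinearMap.lTensor M f.toAddMonoidHom.toIntLinearMap).toAddMonoidHom
    (balancing_le_comap M f)

end Tensor

section Purity

variable {R : Type v} [Ring R] {A B C : Type u} [AddCommGroup A] [Module R A]
  [AddCommGroup B] [Module R B] [AddCommGroup C] [Module R C]

/-- `0 → A → B → C → 0` is a pure exact sequence of left `R`-modules: it is exact, and remains
exact after applying `M ⊗_R -` for every right `R`-module `M`. -/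
structure IsPureShortExact (f : A →ₗ[R] B) (g : B →ₗ[R] C) : Prop where
  injective : Function.Injective f
  exact : Function.Exact f g
  surjective : Function.Surjective g
  tensor_injective : ∀ (M : Type u) [AddCommGroup M] [Module Rᵐᵒᵖ M],
    Function.Injective (RTensor.map M f)
  tensor_exact : ∀ (M : Type u) [AddCommGroup M] [Module Rᵐᵒᵖ M],
    Function.Exact (RTensor.map M f) (RTensor.map M g)
  tensor_surjective : ∀ (M : Type u) [AddCommGroup M] [Module Rᵐᵒᵖ M],
    Function.Surjective (RTensor.map M g)

/-- `f` is pure monic: it is the left-hand map of a pure exact sequence, whose right-hand map is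
then (up to isomorphism) the cokernel of `f`. -/
def IsPureMono (f : A →ₗ[R] B) : Prop :=
  IsPureShortExact f (LinearMap.range f).mkQ

/-- `g` is pure epic: it is the right-hand map of a pure exact sequence, whose left-hand map is
then (up to isomorphism) the kernel of `g`. -/
def IsPureEpi (g : B →ₗ[R] C) : Prop :=
  IsPureShortExact (LinearMap.ker g).subtype g

/-- `d` decomposes as a pure epic followed by a pure monic. -/
def IsPureAdmissible (d : A →ₗ[R] B) : Prop :=
  ∃ (D : ModuleCat.{u} R) (p : A →ₗ[R] D) (i : D →ₗ[R] B),
    IsPureEpi p ∧ IsPureMono i ∧ i ∘ₗ p = d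

/-- Pure exactness at `B` of a piece `A → B → C` of a complex: both differentials decompose as a
pure epic followed by a pure monic, and `0 → Ker e → B → Coker d → 0` is pure exact. -/
structure IsPureExactPair (d : A →ₗ[R] B) (e : B →ₗ[R] C) : Prop where
  admissible_left : IsPureAdmissible d
  admissible_right : IsPureAdmissible e
  shortExact : IsPureShortExact (LinearMap.ker e).subtype (LinearMap.range d).mkQ

end Purity

section Modules

variable {R : Type v} [Ring R]

/-- `M` is pure projective: projective with respect to pure exact sequences. -/
def IsPureProjective (M : ModuleCat.{u} R) : Prop :=
  ∀ (A B C : ModuleCat.{u} R) (f : A →ₗ[R] B) (g : B →ₗ[R] C), IsPureShortExact f g →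
    ∀ h : M →ₗ[R] C, ∃ k : M →ₗ[R] B, g ∘ₗ k = h

/-- `M` is pure injective: injective with respect to pure exact sequences. -/
def IsPureInjective (M : ModuleCat.{u} R) : Prop :=
  ∀ (A B C : ModuleCat.{u} R) (f : A →ₗ[R] B) (g : B →ₗ[R] C), IsPureShortExact f g →
    ∀ h : A →ₗ[R] M, ∃ k : B →ₗ[R] M, k ∘ₗ f = h

end Modules

section Complexes

variable {R : Type v} [Ring R]

/-- The complex `X` is pure exact at `n`. -/
def PureExactAt (X : CochainComplex (ModuleCat.{u} R) ℤ) (n : ℤ) : Prop :=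
  IsPureExactPair (X.d (n - 1) n).hom (X.d n (n + 1)).hom

/-- The complex `X` is pure exact. -/
def PureExact (X : CochainComplex (ModuleCat.{u} R) ℤ) : Prop :=
  ∀ n : ℤ, PureExactAt X n

/-- Pure exactness of a complex of abelian groups, i.e. of `ℤ`-modules. -/
def PureExactAb (X : CochainComplex AddCommGrpCat.{u} ℤ) : Prop :=
  ∀ n : ℤ, IsPureExactPair (X.d (n - 1) n).hom.toIntLinearMap (X.d n (n + 1)).hom.toIntLinearMap

/-- `f` is a pure quasi-isomorphism: its mapping cone is pure exact. -/
def IsPureQuasiIso {X Y : CochainComplex (ModuleCat.{u} R) ℤ} (f : X ⟶ Y) : Prop :=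
  PureExact (CochainComplex.mappingCone f)

/-- `X` is a bounded complex. The bounded complexes are the objects of the bounded homotopy
category and of its quotient, the bounded pure derived category. -/
def IsBounded (X : CochainComplex (ModuleCat.{u} R) ℤ) : Prop :=
  ∃ a b : ℤ, ∀ i : ℤ, (i < a ∨ b < i) → IsZero (X.X i)

/-- The infimum of the degrees in which `X` is not pure exact, in the extended line
(`⊤` if `X` is pure exact, `⊥` if there are arbitrarily small such degrees). -/
def infP (X : CochainComplex (ModuleCat.{u} R) ℤ) : EReal :=
  ⨅ (n : ℤ) (_ : ¬ PureExactAt X n), ((n : ℝ) : EReal)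

/-- The supremum of the degrees in which `X` is not pure exact, in the extended line
(`⊥` if `X` is pure exact, `⊤` if there are arbitrarily large such degrees). -/
def supP (X : CochainComplex (ModuleCat.{u} R) ℤ) : EReal :=
  ⨆ (n : ℤ) (_ : ¬ PureExactAt X n), ((n : ℝ) : EReal)

/-- A pure projective resolution of `X`: a pure quasi-isomorphism `P ⟶ X`, where `P` is a complex
of pure projective modules such that the total Hom complex functor `Hom_R(P, -)` preserves pure
exact complexes. -/
structure PureProjectiveResolution (X : CochainComplex (ModuleCat.{u} R) ℤ) where
  /-- the resolving complex -/
  complex : CochainComplex (ModuleCat.{u} R) ℤ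
  /-- the augmentation -/
  π : complex ⟶ X
  isPureQuasiIso : IsPureQuasiIso π
  isPureProjective : ∀ i : ℤ, IsPureProjective (complex.X i)
  preserves : ∀ Z : CochainComplex (ModuleCat.{u} R) ℤ, PureExact Z →
    PureExactAb (CochainComplex.HomComplex complex Z)

/-- A pure injective resolution of `Y`: a pure quasi-isomorphism `Y ⟶ I`, where `I` is a complex
of pure injective modules such that the total Hom complex functor `Hom_R(-, I)` preserves pure
exact complexes. -/
structure PureInjectiveResolution (Y : CochainComplex (ModuleCat.{u} R) ℤ) where
  /-- the resolving complex -/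
  complex : CochainComplex (ModuleCat.{u} R) ℤ
  /-- the coaugmentation -/
  ι : Y ⟶ complex
  isPureQuasiIso : IsPureQuasiIso ι
  isPureInjective : ∀ i : ℤ, IsPureInjective (complex.X i)
  preserves : ∀ Z : CochainComplex (ModuleCat.{u} R) ℤ, PureExact Z →
    PureExactAb (CochainComplex.HomComplex Z complex)

/-- `X` has pure projective dimension at most the integer `n`. -/
def HasPpdLE (X : CochainComplex (ModuleCat.{u} R) ℤ) (n : ℤ) : Prop :=
  ∃ P : PureProjectiveResolution X, ∀ i : ℤ, i < -n → IsZero (P.complex.X i)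

/-- `Y` has pure injective dimension at most the integer `n`. -/
def HasPidLE (Y : CochainComplex (ModuleCat.{u} R) ℤ) (n : ℤ) : Prop :=
  ∃ I : PureInjectiveResolution Y, ∀ i : ℤ, n < i → IsZero (I.complex.X i)

/-- The pure projective dimension, with values in `ℤ ∪ {±∞}`. -/
def ppd (X : CochainComplex (ModuleCat.{u} R) ℤ) : EReal :=
  ⨅ (n : ℤ) (_ : HasPpdLE X n), ((n : ℝ) : EReal)

/-- The pure injective dimension, with values in `ℤ ∪ {±∞}`. -/
def pid (Y : CochainComplex (ModuleCat.{u} R) ℤ) : EReal :=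
  ⨅ (n : ℤ) (_ : HasPidLE Y n), ((n : ℝ) : EReal)

/-- `Pext_R^i(X, Y) = H^i(Hom_R(P, Y))`, computed with the pure projective resolution `P ⟶ X`. -/
def PureProjectiveResolution.Pext {X : CochainComplex (ModuleCat.{u} R) ℤ}
    (P : PureProjectiveResolution X) (Y : CochainComplex (ModuleCat.{u} R) ℤ) (i : ℤ) :
    AddCommGrpCat.{u} :=
  (CochainComplex.HomComplex P.complex Y).homology i

end Complexes

/-- The left pure global dimension of `R`: the supremum of the pure projective dimensions of all
left `R`-modules, regarded as complexes concentrated in degree `0`. -/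
def pureGlobalDim (R : Type u) [Ring R] : EReal :=
  ⨆ M : ModuleCat.{u} R,
    ppd ((HomologicalComplex.single (ModuleCat.{u} R) (ComplexShape.up ℤ) 0).obj M)

end PureDerived

end

/-!
A complex is pure exact if and only if the maps into it from pure projective modules lift, and if
and only if the maps from it to pure injective modules extend. This rests on the elementwise
description of purity by finite systems of linear equations: homogeneous systems are represented by
pure projective modules, and in a compact Hausdorff module, such as a module of characters, a system
is solvable as soon as its finite subsystems are.

Hence `Pext` can be computed by resolving either variable, and there `X` may be replaced by its
truncation above `inf_p X` and `Y` by its truncation below `sup_p Y`. If `ppd M ≤ n` for all modules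
`M`, then `Hom_R(M, I)` is exact in degrees `> n + sup_p Y` for a pure injective resolution `I` of
`Y`. So the truncation of `I` at `n + sup_p Y` splits off termwise and `pid Y ≤ n + sup_p Y`. For
degree reasons this makes `Pext` vanish in the range of (4), and dually the vanishing of `Pext` with
values in modules lets a pure projective resolution of `X` be truncated at `inf_p X - n`.

Resolutions are required to make Hom complexes pure exact rather than just exact. A family of
cochains `X → Y` solving a finite system over `ℤ` is a single cochain from `X` to the complex of
solutions of the system in `Y`, so purity follows from the exactness of `Hom_R(X, -)` at complexes
of solutions.
-/

universe w

noncomputable section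

namespace PureDerived

section Systems

variable {R : Type v} [Ring R] {A B C D : Type*} [AddCommGroup A] [Module R A]
  [AddCommGroup B] [Module R B] [AddCommGroup C] [Module R C] [AddCommGroup D] [Module R D]

/-- Every finite system of linear equations with constants in `A` which is solvable in `B` is
solvable in `A`. This is the elementwise characterization of the pure monomorphisms. -/
def SolvesSystems (f : A →ₗ[R] B) : Prop :=
  ∀ (ι κ : Type) [Fintype ι] [Fintype κ] (r : ι → κ → R) (a : ι → A) (b : κ → B),
    (∀ i, ∑ j, r i j • b j = f (a i)) → ∃ x : κ → A, ∀ i, ∑ j, r i j • x j = a i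

/-- Solutions in `C` of finite homogeneous systems of linear equations lift along `g` to solutions
in `B`. This is the elementwise characterization of the pure epimorphisms. -/
def LiftsSystems (g : B →ₗ[R] C) : Prop :=
  ∀ (ι κ : Type) [Fintype ι] [Fintype κ] (r : ι → κ → R) (c : κ → C),
    (∀ i, ∑ j, r i j • c j = 0) →
      ∃ b : κ → B, (∀ j, g (b j) = c j) ∧ ∀ i, ∑ j, r i j • b j = 0

theorem SolvesSystems.injective {f : A →ₗ[R] B} (hf : SolvesSystems f) :
    Function.Injective f := by
  rw [injective_iff_map_eq_zero]
  intro a ha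
  obtain ⟨x, hx⟩ := hf Unit Empty (fun _ => Empty.elim) (fun _ => a) Empty.elim (by simp [ha])
  simpa using (hx ()).symm

theorem SolvesSystems.of_comp {f : A →ₗ[R] B} {g : B →ₗ[R] C} (h : SolvesSystems (g ∘ₗ f)) :
    SolvesSystems f := fun ι κ _ _ r a b hb =>
  h ι κ r a (g ∘ b) fun i => by simp [← hb i]

theorem LiftsSystems.surjective {g : B →ₗ[R] C} (hg : LiftsSystems g) :
    Function.Surjective g := fun c => by
  obtain ⟨b, hb, -⟩ := hg Empty Unit Empty.elim (fun _ => c) fun i => i.elim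
  exact ⟨b (), hb ()⟩

theorem SolvesSystems.liftsSystems {f : A →ₗ[R] B} {g : B →ₗ[R] C} (hf : SolvesSystems f)
    (hfg : Function.Exact f g) (hg : Function.Surjective g) : LiftsSystems g := by
  intro ι κ _ _ r c hc
  choose b hb using fun j => hg (c j)
  choose a ha using fun i => (hfg (∑ j, r i j • b j)).1 (by simp [hb, hc])
  obtain ⟨x, hx⟩ := hf ι κ r a b fun i => (ha i).symm
  refine ⟨fun j => b j - f (x j), fun j => ?_, fun i => ?_⟩
  · simp [hb, hfg.apply_apply_eq_zero]
  · simp only [smul_sub, Finset.sum_sub_distrib, ← ha i, ← hx i, map_sum, map_smul, sub_self]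

theorem LiftsSystems.solvesSystems {f : A →ₗ[R] B} {g : B →ₗ[R] C} (hg : LiftsSystems g)
    (hf : Function.Injective f) (hfg : Function.Exact f g) : SolvesSystems f := by
  intro ι κ _ _ r a b hb
  obtain ⟨b', hb', hr⟩ := hg ι κ r (g ∘ b) fun i => by
    simp_rw [Function.comp_apply, ← map_smul, ← map_sum, hb, hfg.apply_apply_eq_zero]
  choose x hx using fun j => (hfg (b j - b' j)).1 (by simp [hb'])
  exact ⟨x, fun i => hf (by simp [hx, smul_sub, hr, hb])⟩

theorem linearCombination_eq_sum_equivFin {ι : Type*} {c : ι →₀ R} {t : Finset ι}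
    (hc : c.support ⊆ t) (y : ι → A) :
    Finsupp.linearCombination R y c = ∑ j, c (t.equivFin.symm j) • y (t.equivFin.symm j) := by
  rw [Finsupp.linearCombination_apply, Finsupp.sum_of_support_subset _ hc _ (by simp),
    ← Finset.sum_coe_sort, ← Equiv.sum_comp t.equivFin.symm]

theorem SolvesSystems.exists_linearCombination_eq {f : A →ₗ[R] B} (hf : SolvesSystems f)
    (s : Finset ((B →₀ R) × A))
    (hs : ∀ e ∈ s, Finsupp.linearCombination R id e.1 = f e.2) :
    ∃ x : B → A, ∀ e ∈ s, Finsupp.linearCombination R x e.1 = e.2 := by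
  classical
  let t : Finset B := s.biUnion fun e => e.1.support
  have support_le (e) (he : e ∈ s) : e.1.support ⊆ t :=
    Finset.subset_biUnion_of_mem (fun e : (B →₀ R) × A => e.1.support) he
  obtain ⟨x, hx⟩ := hf (Fin s.card) (Fin t.card)
    (fun i j => (s.equivFin.symm i).1.1 (t.equivFin.symm j)) (fun i => (s.equivFin.symm i).1.2)
    (fun j => t.equivFin.symm j) fun i => by
      rw [← hs _ (s.equivFin.symm i).2,
        linearCombination_eq_sum_equivFin (support_le _ (s.equivFin.symm i).2)]
      rfl
  refine ⟨fun b => if hb : b ∈ t then x (t.equivFin ⟨b, hb⟩) else 0, fun e he => ?_⟩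
  simpa [linearCombination_eq_sum_equivFin (support_le e he)] using hx (s.equivFin ⟨e, he⟩)

/-- Extending `φ` along `f` means solving an infinite linear system indexed by `B`. Its finite
subsystems are solvable since `f` is pure, and its solution sets are closed. -/
theorem SolvesSystems.exists_extension_of_compactSpace {f : A →ₗ[R] B} (hf : SolvesSystems f)
    [TopologicalSpace C] [CompactSpace C] [T2Space C] [ContinuousAdd C] [ContinuousConstSMul R C]
    (φ : A →ₗ[R] C) : ∃ ψ : B →ₗ[R] C, ψ ∘ₗ f = φ := by
  let Eqn := {e : (B →₀ R) × A // Finsupp.linearCombination R id e.1 = f e.2}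
  let Z (e : Eqn) : Set (B → C) := {h | Finsupp.linearCombination R h e.1.1 = φ e.1.2}
  have isClosed_Z (e : Eqn) : IsClosed (Z e) := by
    refine isClosed_eq ?_ continuous_const
    simp only [Finsupp.linearCombination_apply, Finsupp.sum]
    fun_prop
  obtain ⟨h, hh⟩ : (⋂ e, Z e).Nonempty := by
    refine CompactSpace.iInter_nonempty isClosed_Z fun s => ?_
    classical
    obtain ⟨x, hx⟩ := hf.exists_linearCombination_eq (s.map (Function.Embedding.subtype _))
      fun e he => by
        obtain ⟨e, -, rfl⟩ := Finset.mem_map.1 he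
        exact e.2
    refine ⟨φ ∘ x, Set.mem_iInter₂.2 fun e he => ?_⟩
    change Finsupp.linearCombination R (φ ∘ x) _ = _
    rw [← Finsupp.apply_linearCombination R φ]
    exact congrArg φ (hx _ (Finset.mem_map_of_mem _ he))
  have eqn (c : B →₀ R) (a : A) (hc : Finsupp.linearCombination R id c = f a) :
      Finsupp.linearCombination R h c = φ a := Set.mem_iInter.1 hh ⟨(c, a), hc⟩
  refine ⟨{ toFun := h, map_add' := fun b b' => ?_, map_smul' := fun r b => ?_ },
    LinearMap.ext fun a => ?_⟩
  · have := eqn (Finsupp.single (b + b') 1 - Finsupp.single b 1 - Finsupp.single b' 1) 0 (by simp)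
    simpa [sub_eq_zero, sub_eq_iff_eq_add'] using this
  · have := eqn (Finsupp.single (r • b) 1 - Finsupp.single b r) 0 (by simp)
    simpa [sub_eq_zero] using this
  · simpa using eqn (Finsupp.single (f a) 1) a (by simp)

end Systems

section Character

/-- The group of characters of an abelian group with values in the circle `ℝ / ℤ`, with the topology
of pointwise convergence. Characters of right `R`-modules form left `R`-modules and vice versa. -/
def Character (M : Type u) [AddCommGroup M] : Type u := M →+ UnitAddCircle

namespace Character

variable {R : Type v} [Ring R] {M : Type u} [AddCommGroup M]

instance : AddCommGroup (Character M) := inferInstanceAs (AddCommGroup (M →+ UnitAddCircle))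

instance : FunLike (Character M) M UnitAddCircle :=
  inferInstanceAs (FunLike (M →+ UnitAddCircle) _ _)

instance : AddMonoidHomClass (Character M) M UnitAddCircle :=
  inferInstanceAs (AddMonoidHomClass (M →+ UnitAddCircle) _ _)

@[ext]
theorem ext {χ ψ : Character M} (h : ∀ m, χ m = ψ m) : χ = ψ := DFunLike.ext _ _ h

instance [Module R M] : Module Rᵐᵒᵖ (Character M) :=
  inferInstanceAs (Module Rᵈᵐᵃ (M →+ UnitAddCircle))

instance [Module Rᵐᵒᵖ M] : Module R (Character M) :=
  Module.compHom (Character M) (RingEquiv.opOp R).toRingHom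

theorem op_smul_apply [Module R M] (r : R) (χ : Character M) (m : M) :
    (MulOpposite.op r • χ) m = χ (r • m) := rfl

theorem smul_apply [Module Rᵐᵒᵖ M] (r : R) (χ : Character M) (m : M) :
    (r • χ) m = χ (MulOpposite.op r • m) := rfl

instance : TopologicalSpace (Character M) :=
  TopologicalSpace.induced DFunLike.coe inferInstance

theorem isClosedEmbedding_coe :
    Topology.IsClosedEmbedding (DFunLike.coe : Character M → M → UnitAddCircle) :=
  ⟨⟨⟨rfl⟩, DFunLike.coe_injective⟩, AddMonoidHom.isClosed_range_coe M UnitAddCircle⟩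

instance : CompactSpace (Character M) := isClosedEmbedding_coe.compactSpace

instance : T2Space (Character M) := isClosedEmbedding_coe.isEmbedding.t2Space

@[fun_prop]
theorem continuous_apply (m : M) : Continuous fun χ : Character M => χ m :=
  (_root_.continuous_apply m).comp isClosedEmbedding_coe.continuous

theorem continuous_iff {X : Type*} [TopologicalSpace X] {g : X → Character M} :
    Continuous g ↔ ∀ m, Continuous fun x => g x m :=
  isClosedEmbedding_coe.isInducing.continuous_iff.trans continuous_pi_iff

instance : ContinuousAdd (Character M) where
  continuous_add := continuous_iff.2 fun m =>
    ((continuous_apply m).comp continuous_fst).add ((continuous_apply m).comp continuous_snd)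

instance [Module Rᵐᵒᵖ M] : ContinuousConstSMul R (Character M) where
  continuous_const_smul r := continuous_iff.2 fun m => by simp only [smul_apply]; fun_prop

theorem exists_extension {A B : Type*} [AddCommGroup A] [AddCommGroup B] {f : A →+ B}
    (hf : Function.Injective f) (χ : A →+ UnitAddCircle) : ∃ ψ : B →+ UnitAddCircle, ψ.comp f = χ :=
  (Module.Baer.of_divisible _).extension_property_addMonoidHom f hf χ

theorem exists_apply_ne_zero {A : Type*} [AddCommGroup A] {a : A} (ha : a ≠ 0) :
    ∃ χ : A →+ UnitAddCircle, χ a ≠ 0 := by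
  obtain ⟨χ, hχ⟩ := CharacterModule.exists_character_apply_ne_zero_of_ne_zero ha
  let j : AddCircle (1 : ℚ) →+ UnitAddCircle :=
    QuotientAddGroup.map _ _ (Rat.castHom ℝ).toAddMonoidHom (by simp)
  have hj : Function.Injective j := by
    rw [injective_iff_map_eq_zero]
    intro x
    induction x using QuotientAddGroup.induction_on with | H q =>
    intro hq
    obtain ⟨n, hn⟩ := (AddCircle.coe_eq_zero_iff 1).1 (show ((q : ℝ) : UnitAddCircle) = 0 from hq)
    refine (AddCircle.coe_eq_zero_iff 1).2 ⟨n, ?_⟩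
    have : ((n : ℚ) : ℝ) = q := by simpa using hn
    simpa using Rat.cast_injective this
  exact ⟨j.comp χ, fun h => hχ (hj (h.trans (map_zero j).symm))⟩

theorem exists_vanishing_on {A : Type*} [AddCommGroup A] {H : AddSubgroup A} {a : A} (ha : a ∉ H) :
    ∃ χ : A →+ UnitAddCircle, (∀ b ∈ H, χ b = 0) ∧ χ a ≠ 0 := by
  obtain ⟨χ, hχ⟩ := exists_apply_ne_zero (mt (QuotientAddGroup.eq_zero_iff a).1 ha)
  refine ⟨χ.comp (QuotientAddGroup.mk' H), fun b hb => ?_, hχ⟩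
  simp [(QuotientAddGroup.eq_zero_iff b).2 hb]

end Character
end Character

theorem exists_comp_eq_of_range_le {R A B C : Type*} [Ring R] [AddCommGroup A] [Module R A]
    [AddCommGroup B] [Module R B] [AddCommGroup C] [Module R C] {i : A →ₗ[R] B}
    (hi : Function.Injective i) {h : C →ₗ[R] B} (range_le : LinearMap.range h ≤ LinearMap.range i) :
    ∃ k : C →ₗ[R] A, i ∘ₗ k = h := by
  let e := LinearEquiv.ofInjective i hi
  refine ⟨e.symm.toLinearMap ∘ₗ h.codRestrict _ fun x => range_le ⟨x, rfl⟩,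
    LinearMap.ext fun x => ?_⟩
  exact congrArg Subtype.val (e.apply_symm_apply ⟨h x, range_le ⟨x, rfl⟩⟩)

theorem exists_comp_eq_of_ker_le {R A B C : Type*} [Ring R] [AddCommGroup A] [Module R A]
    [AddCommGroup B] [Module R B] [AddCommGroup C] [Module R C] {p : A →ₗ[R] B}
    (hp : Function.Surjective p) {h : A →ₗ[R] C} (ker_le : LinearMap.ker p ≤ LinearMap.ker h) :
    ∃ k : B →ₗ[R] C, k ∘ₗ p = h := by
  refine ⟨(LinearMap.ker p).liftQ h ker_le ∘ₗ (p.quotKerEquivOfSurjective hp).symm.toLinearMap,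
    LinearMap.ext fun x => ?_⟩
  have : (p.quotKerEquivOfSurjective hp).symm (p x) = (LinearMap.ker p).mkQ x := by
    rw [LinearEquiv.symm_apply_eq]; rfl
  simp [this]

section Tensor

variable {R : Type v} [Ring R] {M A B C : Type u} [AddCommGroup M] [Module Rᵐᵒᵖ M]
  [AddCommGroup A] [Module R A] [AddCommGroup B] [Module R B] [AddCommGroup C] [Module R C]

namespace RTensor

variable (R M A) in
/-- The biadditive map `(m, a) ↦ m ⊗ a` into `M ⊗_R A`. -/
def tmul : M →+ A →+ RTensor (R := R) M A :=
  AddMonoidHom.mk' (fun m => (QuotientAddGroup.mk' _).comp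
    (TensorProduct.mk ℤ M A m).toAddMonoidHom) fun m m' => by ext; simp

theorem smul_tmul (m : M) (r : R) (a : A) :
    tmul R M A (MulOpposite.op r • m) a = tmul R M A m (r • a) := by
  rw [← sub_eq_zero]
  exact (QuotientAddGroup.eq_zero_iff _).2 (AddSubgroup.subset_closure ⟨m, r, a, rfl⟩)

theorem map_tmul (f : A →ₗ[R] B) (m : M) (a : A) :
    map M f (tmul R M A m a) = tmul R M B m (f a) := rfl

theorem induction {p : RTensor (R := R) M A → Prop} (zero : p 0)
    (tmul : ∀ m a, p (tmul R M A m a)) (add : ∀ x y, p x → p y → p (x + y)) (x) : p x := by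
  obtain ⟨x, rfl⟩ := QuotientAddGroup.mk_surjective x
  induction x using TensorProduct.induction_on with
  | zero => exact zero
  | tmul m a => exact tmul m a
  | add x y hx hy => exact add _ _ hx hy

theorem hom_ext {G : Type*} [AddCommGroup G] {φ ψ : RTensor (R := R) M A →+ G}
    (h : ∀ m a, φ (tmul R M A m a) = ψ (tmul R M A m a)) : φ = ψ := by
  refine DFunLike.ext _ _ fun x => ?_
  induction x using RTensor.induction with
  | zero => simp
  | tmul m a => exact h m a
  | add x y hx hy => simp only [map_add, hx, hy]

/-- A homomorphism `M ⊗_R A → ℝ / ℤ` as a linear map from `A` to the characters of `M`. -/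
def curry (χ : RTensor (R := R) M A →+ UnitAddCircle) : A →ₗ[R] Character M where
  toFun a := χ.comp ((tmul R M A).flip a)
  map_add' a b := Character.ext fun m => by
    change χ (tmul R M A m (a + b)) = χ (tmul R M A m a) + χ (tmul R M A m b)
    simp only [map_add]
  map_smul' r a := Character.ext fun m => congrArg χ (smul_tmul m r a).symm

/-- The inverse of `RTensor.curry`. -/
def uncurry (φ : A →ₗ[R] Character M) : RTensor (R := R) M A →+ UnitAddCircle :=
  QuotientAddGroup.lift _
    (TensorProduct.liftAddHom (AddMonoidHom.flip φ.toAddMonoidHom) fun z m a => by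
      change φ a (z • m) = φ (z • a) m
      rw [map_zsmul, map_zsmul]; rfl) <|
    (AddSubgroup.closure_le _).2 <| by
      rintro _ ⟨m, r, a, rfl⟩
      change TensorProduct.liftAddHom _ _ _ = 0
      rw [map_sub, sub_eq_zero]
      exact (DFunLike.congr_fun (φ.map_smul r a) m).symm

theorem uncurry_comp (φ : B →ₗ[R] Character M) (f : A →ₗ[R] B) :
    uncurry (φ ∘ₗ f) = (uncurry φ).comp (map M f) := hom_ext fun _ _ => rfl

theorem uncurry_curry (χ : RTensor (R := R) M A →+ UnitAddCircle) : uncurry (curry χ) = χ :=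
  hom_ext fun _ _ => rfl

theorem map_injective_iff {f : A →ₗ[R] B} : Function.Injective (map M f) ↔
    ∀ φ : A →ₗ[R] Character M, ∃ ψ : B →ₗ[R] Character M, ψ ∘ₗ f = φ := by
  constructor
  · intro hf φ
    obtain ⟨χ, hχ⟩ := Character.exists_extension hf (uncurry φ)
    exact ⟨curry χ, LinearMap.ext fun a => Character.ext fun m =>
      DFunLike.congr_fun hχ (tmul R M A m a)⟩
  · intro hf
    rw [injective_iff_map_eq_zero]
    intro x hx
    by_contra hx'
    obtain ⟨χ, hχ⟩ := Character.exists_apply_ne_zero hx'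
    obtain ⟨ψ, hψ⟩ := hf (curry χ)
    refine hχ ?_
    rw [← uncurry_curry χ, ← hψ, uncurry_comp, AddMonoidHom.comp_apply, hx, map_zero]

theorem map_surjective {g : B →ₗ[R] C} (hg : Function.Surjective g) :
    Function.Surjective (map M g) := by
  intro x
  induction x using RTensor.induction with
  | zero => exact ⟨0, map_zero _⟩
  | tmul m c =>
    obtain ⟨b, rfl⟩ := hg c
    exact ⟨_, map_tmul g m b⟩
  | add x y hx hy =>
    obtain ⟨x, rfl⟩ := hx
    obtain ⟨y, rfl⟩ := hy
    exact ⟨x + y, map_add _ _ _⟩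

theorem map_exact {f : A →ₗ[R] B} {g : B →ₗ[R] C} (hfg : Function.Exact f g)
    (hg : Function.Surjective g) : Function.Exact (map M f) (map M g) := by
  have comp_zero : (map M g).comp (map M f) = 0 := hom_ext fun m a => by
    simp [map_tmul, hfg.apply_apply_eq_zero]
  refine fun x => ⟨fun hx => ?_, ?_⟩
  · by_contra hx'
    obtain ⟨χ, hχ, hχx⟩ := Character.exists_vanishing_on (H := (map M f).range) hx'
    obtain ⟨ψ, hψ⟩ : ∃ ψ : C →ₗ[R] Character M, ψ ∘ₗ g = curry χ := by
      have ker_le : LinearMap.ker g ≤ LinearMap.ker (curry χ) := fun b hb => by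
        obtain ⟨a, rfl⟩ := (hfg b).1 hb
        exact Character.ext fun m => hχ _ ⟨_, map_tmul f m a⟩
      exact exists_comp_eq_of_ker_le hg ker_le
    refine hχx ?_
    rw [← uncurry_curry χ, ← hψ, uncurry_comp, AddMonoidHom.comp_apply, hx, map_zero]
  · rintro ⟨y, rfl⟩
    exact DFunLike.congr_fun comp_zero y

end RTensor

variable (R A) in
/-- The canonical map from a module to its double character module. -/
def charEval : A →ₗ[R] Character (Character A) where
  toFun a := (AddMonoidHom.eval a : (A →+ UnitAddCircle) →+ UnitAddCircle)
  map_add' a b := Character.ext fun χ => map_add χ a b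
  map_smul' _ _ := rfl

theorem charEval_apply (a : A) (χ : Character A) : charEval R A a χ = χ a := rfl

end Tensor

section Purity

variable {R : Type v} [Ring R] {A B C : Type u} [AddCommGroup A] [Module R A]
  [AddCommGroup B] [Module R B] [AddCommGroup C] [Module R C]

variable (R A) in
theorem solvesSystems_charEval : SolvesSystems (charEval R A) := by
  classical
  intro ι κ _ _ r a Ξ hΞ
  let T : (κ → A) →+ (ι → A) := AddMonoidHom.mk' (fun y i => ∑ j, r i j • y j) fun y z => by
    ext; simp [smul_add, Finset.sum_add_distrib]
  suffices a ∈ T.range by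
    obtain ⟨y, rfl⟩ := this
    exact ⟨y, fun i => rfl⟩
  by_contra ha
  obtain ⟨χ, hχT, hχa⟩ := Character.exists_vanishing_on ha
  let χ' (i : ι) : Character A := χ.comp (AddMonoidHom.single (fun _ => A) i)
  have χ_apply (y : ι → A) : χ y = ∑ i, χ' i (y i) := by
    conv_lhs => rw [← Finset.univ_sum_single y, map_sum]
    rfl
  have χ'_relation (j : κ) : ∑ i, MulOpposite.op (r i j) • χ' i = 0 := by
    refine Character.ext fun y => ?_
    rw [← charEval_apply (R := R), map_sum]
    refine Eq.trans ?_ (hχT _ ⟨Pi.single j y, rfl⟩)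
    simp [χ_apply, T, Pi.single_apply, charEval_apply, Character.op_smul_apply]
  refine hχa ?_
  calc χ a = ∑ i, charEval R A (a i) (χ' i) := χ_apply a
    _ = ∑ i, (∑ j, r i j • Ξ j) (χ' i) := by simp only [hΞ]
    _ = ∑ i, ∑ j, Ξ j (MulOpposite.op (r i j) • χ' i) := by
      refine Finset.sum_congr rfl fun i _ => ?_
      rw [← charEval_apply (R := ℤ), map_sum]
      rfl
    _ = ∑ j, Ξ j (∑ i, MulOpposite.op (r i j) • χ' i) := by
      simp only [map_sum]
      exact Finset.sum_comm
    _ = 0 := by simp [χ'_relation]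

theorem SolvesSystems.tensor_injective {f : A →ₗ[R] B} (hf : SolvesSystems f) (M : Type u)
    [AddCommGroup M] [Module Rᵐᵒᵖ M] : Function.Injective (RTensor.map M f) :=
  RTensor.map_injective_iff.2 hf.exists_extension_of_compactSpace

theorem solvesSystems_of_tensor_injective {f : A →ₗ[R] B}
    (hf : Function.Injective (RTensor.map (Character A) f)) : SolvesSystems f := by
  obtain ⟨ψ, hψ⟩ := RTensor.map_injective_iff.1 hf (charEval R A)
  exact SolvesSystems.of_comp (hψ ▸ solvesSystems_charEval R A)

theorem SolvesSystems.isPureShortExact {f : A →ₗ[R] B} {g : B →ₗ[R] C} (hf : SolvesSystems f)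
    (hfg : Function.Exact f g) (hg : Function.Surjective g) : IsPureShortExact f g where
  injective := hf.injective
  exact := hfg
  surjective := hg
  tensor_injective M _ _ := hf.tensor_injective M
  tensor_exact _ _ _ := RTensor.map_exact hfg hg
  tensor_surjective _ _ _ := RTensor.map_surjective hg

theorem IsPureShortExact.solvesSystems {f : A →ₗ[R] B} {g : B →ₗ[R] C}
    (h : IsPureShortExact f g) : SolvesSystems f :=
  solvesSystems_of_tensor_injective (h.tensor_injective _)

theorem IsPureShortExact.liftsSystems {f : A →ₗ[R] B} {g : B →ₗ[R] C}
    (h : IsPureShortExact f g) : LiftsSystems g :=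
  h.solvesSystems.liftsSystems h.exact h.surjective

theorem isPureMono_iff_solvesSystems {f : A →ₗ[R] B} : IsPureMono f ↔ SolvesSystems f :=
  ⟨IsPureShortExact.solvesSystems,
    fun h => h.isPureShortExact (LinearMap.exact_map_mkQ_range f) (Submodule.mkQ_surjective _)⟩

theorem isPureEpi_iff_liftsSystems {g : B →ₗ[R] C} : IsPureEpi g ↔ LiftsSystems g := by
  have exact : Function.Exact (LinearMap.ker g).subtype g := LinearMap.exact_subtype_ker_map g
  exact ⟨IsPureShortExact.liftsSystems, fun h =>
    (h.solvesSystems (Submodule.subtype_injective _) exact).isPureShortExact exact h.surjective⟩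

end Purity

section PureInjective

variable {R : Type v} [Ring R] {A B : Type u} [AddCommGroup A] [Module R A]
  [AddCommGroup B] [Module R B]

theorem isPureInjective_of_compactSpace (C : Type u) [AddCommGroup C] [Module R C]
    [TopologicalSpace C] [CompactSpace C] [T2Space C] [ContinuousAdd C] [ContinuousConstSMul R C] :
    IsPureInjective (ModuleCat.of R C) :=
  fun _ _ _ _ _ h φ => h.solvesSystems.exists_extension_of_compactSpace φ

theorem IsPureInjective.exists_extension {E : ModuleCat.{u} R} (hE : IsPureInjective E)
    {f : A →ₗ[R] B} (hf : SolvesSystems f) (h : A →ₗ[R] E) :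
    ∃ k : B →ₗ[R] E, k ∘ₗ f = h :=
  hE (ModuleCat.of R A) (ModuleCat.of R B) (ModuleCat.of R (B ⧸ LinearMap.range f)) f _
    (isPureMono_iff_solvesSystems.2 hf) h

theorem IsPureInjective.of_retract {E F : ModuleCat.{u} R} (hE : IsPureInjective E)
    {i : F →ₗ[R] E} {p : E →ₗ[R] F} (hip : p ∘ₗ i = LinearMap.id) : IsPureInjective F := by
  intro A B C f g hfg h
  obtain ⟨k, hk⟩ := hE A B C f g hfg (i ∘ₗ h)
  exact ⟨p ∘ₗ k, by rw [LinearMap.comp_assoc, hk, ← LinearMap.comp_assoc, hip, LinearMap.id_comp]⟩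

theorem isPureInjective_character (M : Type u) [AddCommGroup M] [Module Rᵐᵒᵖ M] :
    IsPureInjective (ModuleCat.of R (Character M)) :=
  isPureInjective_of_compactSpace (Character M)

theorem IsPureInjective.exists_retraction_charEval {E : ModuleCat.{u} R} (hE : IsPureInjective E) :
    ∃ p : Character (Character E) →ₗ[R] E, p ∘ₗ charEval R E = LinearMap.id :=
  hE.exists_extension (solvesSystems_charEval R E) LinearMap.id

theorem isPureInjective_of_subsingleton (E : ModuleCat.{u} R) [Subsingleton E] :
    IsPureInjective E :=
  fun _ _ _ _ _ _ _ => ⟨0, LinearMap.ext fun _ => Subsingleton.elim _ _⟩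

variable (A) in
theorem exists_pureInjective_embedding :
    ∃ (E : ModuleCat.{u} R) (f : A →ₗ[R] E), IsPureInjective E ∧ SolvesSystems f :=
  ⟨_, _, isPureInjective_character (Character A), solvesSystems_charEval R A⟩

theorem solvesSystems_iff_forall_isPureInjective {f : A →ₗ[R] B} :
    SolvesSystems f ↔ ∀ E : ModuleCat.{u} R, IsPureInjective E → ∀ h : A →ₗ[R] E,
      ∃ k : B →ₗ[R] E, k ∘ₗ f = h := by
  refine ⟨fun hf _ hE => hE.exists_extension hf, fun hf => ?_⟩
  obtain ⟨E, h, hE, hh⟩ := exists_pureInjective_embedding (R := R) A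
  obtain ⟨k, rfl⟩ := hf E hE h
  exact hh.of_comp

end PureInjective

section PureProjective

variable {R : Type v} [Ring R] {B C : Type u} [AddCommGroup B] [Module R B]
  [AddCommGroup C] [Module R C]

theorem IsPureProjective.exists_lift {P : ModuleCat.{u} R} (hP : IsPureProjective P)
    {g : B →ₗ[R] C} (hg : LiftsSystems g) (h : P →ₗ[R] C) : ∃ k : P →ₗ[R] B, g ∘ₗ k = h :=
  hP (ModuleCat.of R (LinearMap.ker g)) (ModuleCat.of R B) (ModuleCat.of R C) _ g
    (isPureEpi_iff_liftsSystems.2 hg) h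

theorem IsPureProjective.of_retract {P Q : ModuleCat.{u} R} (hP : IsPureProjective P)
    {i : Q →ₗ[R] P} {p : P →ₗ[R] Q} (hip : p ∘ₗ i = LinearMap.id) : IsPureProjective Q := by
  intro A B C f g hfg h
  obtain ⟨k, hk⟩ := hP A B C f g hfg (h ∘ₗ p)
  exact ⟨k ∘ₗ i, by rw [← LinearMap.comp_assoc, hk, LinearMap.comp_assoc, hip, LinearMap.comp_id]⟩

theorem isPureProjective_of_subsingleton (P : ModuleCat.{u} R) [Subsingleton P] :
    IsPureProjective P :=
  fun _ _ _ _ _ _ _ => ⟨0, LinearMap.ext fun x => by simp [Subsingleton.elim x 0]⟩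

theorem isPureProjective_directSum {ι : Type u} (P : ι → ModuleCat.{u} R)
    (hP : ∀ i, IsPureProjective (P i)) :
    IsPureProjective (ModuleCat.of R (DirectSum ι fun i => P i)) := by
  classical
  intro A B C f g hfg h
  choose k hk using fun i => hP i A B C f g hfg (h ∘ₗ DirectSum.lof R ι (fun i => P i) i)
  refine ⟨DirectSum.toModule R ι B k, DirectSum.linearMap_ext _ fun i => ?_⟩
  rw [← hk i]
  ext x
  simp

end PureProjective

section SystemModule

variable {R : Type u} [Ring R]

/-- The module with generators indexed by `κ` and the rows of the matrix `r` as relations. Maps out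
of it are the solutions of the homogeneous system of linear equations with matrix `r`. -/
def systemModule {ι κ : Type} (r : ι → κ → R) : ModuleCat.{u} R :=
  ModuleCat.of R ((κ → R) ⧸ Submodule.span R (Set.range r))

/-- The generators of `systemModule r`. -/
def systemModule.gen {ι κ : Type} [DecidableEq κ] (r : ι → κ → R) (j : κ) : systemModule r :=
  Submodule.Quotient.mk (Pi.single j 1)

theorem systemModule.hom_ext {ι κ : Type} [Finite κ] [DecidableEq κ] {r : ι → κ → R} {C : Type*}
    [AddCommGroup C] [Module R C] {f g : systemModule r →ₗ[R] C}
    (h : ∀ j, f (systemModule.gen r j) = g (systemModule.gen r j)) : f = g :=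
  Submodule.linearMap_qext _ (LinearMap.pi_ext' fun j => LinearMap.ext_ring (h j))

variable {ι κ : Type} [Fintype κ] [DecidableEq κ] (r : ι → κ → R)

theorem systemModule.relation (i : ι) : ∑ j, r i j • systemModule.gen r j = 0 := by
  have row : ∑ j, r i j • (Pi.single j 1 : κ → R) = r i := (pi_eq_sum_univ' _).symm
  have mk_row := congrArg (Submodule.span R (Set.range r)).mkQ row
  simp only [map_sum, map_smul] at mk_row
  exact mk_row.trans ((Submodule.Quotient.mk_eq_zero _).2 (Submodule.subset_span ⟨i, rfl⟩))

variable {C : Type*} [AddCommGroup C] [Module R C]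

theorem systemModule.exists_hom (c : κ → C) (hc : ∀ i, ∑ j, r i j • c j = 0) :
    ∃ f : systemModule r →ₗ[R] C, ∀ j, f (systemModule.gen r j) = c j := by
  refine ⟨Submodule.liftQ _ (Fintype.linearCombination R c) ?_, fun j => ?_⟩
  · rw [Submodule.span_le]
    rintro _ ⟨i, rfl⟩
    simpa only [SetLike.mem_coe, LinearMap.mem_ker, Fintype.linearCombination_apply] using hc i
  · change Fintype.linearCombination R c (Pi.single j 1) = c j
    simp [Fintype.linearCombination_apply_single]

theorem isPureProjective_systemModule {ι κ : Type} [Finite ι] [Finite κ] (r : ι → κ → R) :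
    IsPureProjective (systemModule r) := by
  classical
  cases nonempty_fintype ι
  cases nonempty_fintype κ
  intro A B C f g hfg h
  obtain ⟨b, hb, hr⟩ := hfg.liftsSystems ι κ r (fun j => h (systemModule.gen r j)) fun i => by
    simp_rw [← map_smul, ← map_sum, systemModule.relation, map_zero]
  obtain ⟨k, hk⟩ := systemModule.exists_hom r b hr
  exact ⟨k, systemModule.hom_ext fun j => by simp [hk, hb]⟩

end SystemModule

section Cover

variable {R : Type u} [Ring R] {B C : Type u} [AddCommGroup B] [Module R B] [AddCommGroup C]
  [Module R C]

theorem liftsSystems_of_exists_lift_systemModule {g : B →ₗ[R] C}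
    (hg : ∀ (k l : ℕ) (r : Fin k → Fin l → R) (h : systemModule r →ₗ[R] C),
      ∃ h' : systemModule r →ₗ[R] B, g ∘ₗ h' = h) : LiftsSystems g := by
  intro ι κ _ _ r c hc
  let e := Fintype.equivFin ι
  let e' := Fintype.equivFin κ
  let r' (i j) : R := r (e.symm i) (e'.symm j)
  obtain ⟨h, hh⟩ := systemModule.exists_hom r' (c ∘ e'.symm) fun i =>
    (Equiv.sum_comp e'.symm fun j => r (e.symm i) j • c j).trans (hc _)
  obtain ⟨h', rfl⟩ := hg _ _ r' h
  refine ⟨fun j => h' (systemModule.gen r' (e' j)), fun j => ?_, fun i => ?_⟩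
  · simpa using hh (e' j)
  · have relation := congrArg h' (systemModule.relation r' (e i))
    rw [← Equiv.sum_comp e'] at relation
    simpa [r'] using relation

theorem liftsSystems_iff_forall_isPureProjective {g : B →ₗ[R] C} :
    LiftsSystems g ↔ ∀ P : ModuleCat.{u} R, IsPureProjective P → ∀ h : P →ₗ[R] C,
      ∃ k : P →ₗ[R] B, g ∘ₗ k = h :=
  ⟨fun hg _ hP => hP.exists_lift hg, fun hg => liftsSystems_of_exists_lift_systemModule
    fun _ _ r => hg _ (isPureProjective_systemModule r)⟩

variable (C) in
theorem exists_pureProjective_cover :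
    ∃ (P : ModuleCat.{u} R) (g : P →ₗ[R] C), IsPureProjective P ∧ LiftsSystems g := by
  classical
  let S := Σ (k l : ℕ) (r : Fin k → Fin l → R), systemModule r →ₗ[R] C
  let M (s : S) : ModuleCat.{u} R := systemModule s.2.2.1
  let g : (DirectSum S fun s => M s) →ₗ[R] C := DirectSum.toModule R S C fun s => s.2.2.2
  refine ⟨_, g, isPureProjective_directSum M fun s => isPureProjective_systemModule _,
    liftsSystems_of_exists_lift_systemModule fun k l r h => ?_⟩
  let s : S := ⟨k, l, r, h⟩
  refine ⟨DirectSum.lof R S (fun s => M s) s, LinearMap.ext fun x => ?_⟩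
  simp [g, s]

end Cover

section Pairs

variable {R : Type v} [Ring R] {A B C D F : Type u} [AddCommGroup A] [Module R A]
  [AddCommGroup B] [Module R B] [AddCommGroup C] [Module R C] [AddCommGroup D] [Module R D]
  [AddCommGroup F] [Module R F]

/-- Solutions in `Ker e` of finite homogeneous systems of linear equations lift along `d` to
solutions in `A`. For consecutive differentials of a complex, this is the elementwise form of pure
exactness. -/
def ExactOnSystems (d : A →ₗ[R] B) (e : B →ₗ[R] C) : Prop :=
  ∀ (ι κ : Type) [Fintype ι] [Fintype κ] (r : ι → κ → R) (c : κ → B),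
    (∀ j, e (c j) = 0) → (∀ i, ∑ j, r i j • c j = 0) →
      ∃ b : κ → A, (∀ j, d (b j) = c j) ∧ ∀ i, ∑ j, r i j • b j = 0

variable {d₀ : A →ₗ[R] B} {d₁ : B →ₗ[R] C} {d₂ : C →ₗ[R] D} {d₃ : D →ₗ[R] F}

theorem exactOnSystems_iff_liftsSystems_codRestrict (h₁₀ : ∀ x, d₁ (d₀ x) = 0) :
    ExactOnSystems d₀ d₁ ↔ LiftsSystems (d₀.codRestrict (LinearMap.ker d₁) h₁₀) := by
  refine ⟨fun h ι κ _ _ r c hc => ?_, fun h ι κ _ _ r c hc hr => ?_⟩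
  · obtain ⟨b, hb, hr⟩ := h ι κ r (fun j => c j) (fun j => (c j).2) fun i => by
      simpa using congrArg Subtype.val (hc i)
    exact ⟨b, fun j => Subtype.ext (hb j), hr⟩
  · obtain ⟨b, hb, hr⟩ := h ι κ r (fun j => ⟨c j, hc j⟩) fun i => Subtype.ext (by simpa using hr i)
    exact ⟨b, fun j => congrArg Subtype.val (hb j), hr⟩

theorem exactOnSystems_iff_solvesSystems_subtype (h₁₀ : ∀ x, d₁ (d₀ x) = 0) :
    ExactOnSystems d₀ d₁ ↔
      Function.Exact d₀ d₁ ∧ SolvesSystems (LinearMap.ker d₀).subtype := by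
  have exact : Function.Exact (LinearMap.ker d₀).subtype
      (d₀.codRestrict (LinearMap.ker d₁) h₁₀) := fun x =>
    ⟨fun hx => ⟨⟨x, congrArg Subtype.val hx⟩, rfl⟩, by rintro ⟨y, rfl⟩; exact Subtype.ext y.2⟩
  rw [exactOnSystems_iff_liftsSystems_codRestrict h₁₀]
  refine ⟨fun h => ⟨fun y => ⟨fun hy => ?_, ?_⟩,
    h.solvesSystems (Submodule.subtype_injective _) exact⟩,
    fun h => h.2.liftsSystems exact fun y => ?_⟩
  · obtain ⟨x, hx⟩ := h.surjective ⟨y, hy⟩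
    exact ⟨x, congrArg Subtype.val hx⟩
  · rintro ⟨x, rfl⟩
    exact h₁₀ x
  · obtain ⟨x, hx⟩ := (h.1 y).1 y.2
    exact ⟨x, Subtype.ext hx⟩

theorem isPureAdmissible_of_exactOnSystems (h₁₀ : ∀ x, d₁ (d₀ x) = 0)
    (h₂₁ : ∀ x, d₂ (d₁ x) = 0) (h₁ : ExactOnSystems d₀ d₁) (h₂ : ExactOnSystems d₁ d₂) :
    IsPureAdmissible d₀ :=
  ⟨ModuleCat.of R (LinearMap.ker d₁), _, _,
    isPureEpi_iff_liftsSystems.2 ((exactOnSystems_iff_liftsSystems_codRestrict h₁₀).1 h₁),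
    isPureMono_iff_solvesSystems.2 ((exactOnSystems_iff_solvesSystems_subtype h₂₁).1 h₂).2, rfl⟩

theorem isPureExactPair_of_exactOnSystems (h₁₀ : ∀ x, d₁ (d₀ x) = 0) (h₂₁ : ∀ x, d₂ (d₁ x) = 0)
    (h₃₂ : ∀ x, d₃ (d₂ x) = 0) (h₁ : ExactOnSystems d₀ d₁) (h₂ : ExactOnSystems d₁ d₂)
    (h₃ : ExactOnSystems d₂ d₃) : IsPureExactPair d₀ d₁ where
  admissible_left := isPureAdmissible_of_exactOnSystems h₁₀ h₂₁ h₁ h₂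
  admissible_right := isPureAdmissible_of_exactOnSystems h₂₁ h₃₂ h₂ h₃
  shortExact := by
    have range_eq_ker := ((exactOnSystems_iff_solvesSystems_subtype h₁₀).1 h₁).1.linearMap_ker_eq
    refine ((exactOnSystems_iff_solvesSystems_subtype h₂₁).1 h₂).2.isPureShortExact
      (fun x => ?_) (Submodule.mkQ_surjective _)
    simp [← range_eq_ker]

theorem IsPureExactPair.exact (h : IsPureExactPair d₀ d₁) : Function.Exact d₀ d₁ := fun x => by
  simpa using (h.shortExact.exact x).symm

theorem IsPureExactPair.exists_lift (h : IsPureExactPair d₀ d₁) {P : ModuleCat.{u} R}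
    (hP : IsPureProjective P) (f : P →ₗ[R] B) (hf : d₁ ∘ₗ f = 0) :
    ∃ k : P →ₗ[R] A, d₀ ∘ₗ k = f := by
  have exact := h.exact
  obtain ⟨D, p, i, hp, hi, rfl⟩ := h.admissible_left
  have range_le : LinearMap.range f ≤ LinearMap.range i := by
    rintro _ ⟨x, rfl⟩
    obtain ⟨a, ha⟩ := (exact (f x)).1 (LinearMap.congr_fun hf x)
    exact ⟨p a, ha⟩
  obtain ⟨f', rfl⟩ := exists_comp_eq_of_range_le hi.injective range_le
  obtain ⟨k, rfl⟩ := hP.exists_lift (isPureEpi_iff_liftsSystems.1 hp) f'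
  exact ⟨k, rfl⟩

theorem IsPureExactPair.exists_extension (h : IsPureExactPair d₀ d₁) {E : ModuleCat.{u} R}
    (hE : IsPureInjective E) (f : B →ₗ[R] E) (hf : f ∘ₗ d₀ = 0) :
    ∃ k : C →ₗ[R] E, k ∘ₗ d₁ = f := by
  have exact := h.exact
  obtain ⟨D, p, i, hp, hi, rfl⟩ := h.admissible_right
  have ker_le : LinearMap.ker p ≤ LinearMap.ker f := fun x hx => by
    obtain ⟨a, rfl⟩ := (exact x).1 (by simp [LinearMap.mem_ker.1 hx])
    exact LinearMap.congr_fun hf a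
  obtain ⟨f', rfl⟩ := exists_comp_eq_of_ker_le hp.surjective ker_le
  obtain ⟨k, rfl⟩ := hE.exists_extension (isPureMono_iff_solvesSystems.1 hi) f'
  exact ⟨k, rfl⟩

end Pairs

section Complexes

variable {R : Type u} [Ring R]

/-- `Hom_R(M, X)` is exact in degree `n`. -/
def LiftsAt (M : ModuleCat.{u} R) (X : CochainComplex (ModuleCat.{u} R) ℤ) (n : ℤ) : Prop :=
  ∀ (i k : ℤ) (_ : i + 1 = n) (_ : n + 1 = k) (h : M ⟶ X.X n), h ≫ X.d n k = 0 →
    ∃ l : M ⟶ X.X i, l ≫ X.d i n = h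

/-- `Hom_R(X, E)` is exact in degree `-n`. -/
def ExtendsAt (E : ModuleCat.{u} R) (X : CochainComplex (ModuleCat.{u} R) ℤ) (n : ℤ) : Prop :=
  ∀ (i k : ℤ) (_ : i + 1 = n) (_ : n + 1 = k) (h : X.X n ⟶ E), X.d i n ≫ h = 0 →
    ∃ l : X.X k ⟶ E, X.d n k ≫ l = h

variable {X : CochainComplex (ModuleCat.{u} R) ℤ}

theorem PureExactAt.liftsAt {n : ℤ} (h : PureExactAt X n) {P : ModuleCat.{u} R}
    (hP : IsPureProjective P) : LiftsAt P X n := by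
  intro i k hi hk f hf
  obtain rfl : i = n - 1 := by lia
  subst hk
  obtain ⟨l, hl⟩ := IsPureExactPair.exists_lift h hP f.hom (congrArg ModuleCat.Hom.hom hf)
  exact ⟨ModuleCat.ofHom l, ModuleCat.hom_ext hl⟩

theorem PureExactAt.extendsAt {n : ℤ} (h : PureExactAt X n) {E : ModuleCat.{u} R}
    (hE : IsPureInjective E) : ExtendsAt E X n := by
  intro i k hi hk f hf
  obtain rfl : i = n - 1 := by lia
  subst hk
  obtain ⟨l, hl⟩ := IsPureExactPair.exists_extension h hE f.hom (congrArg ModuleCat.Hom.hom hf)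
  exact ⟨ModuleCat.ofHom l, ModuleCat.hom_ext hl⟩

theorem d_hom_apply_d_hom_apply (X : CochainComplex (ModuleCat.{u} R) ℤ) (i j k : ℤ) (x : X.X i) :
    X.d j k (X.d i j x) = 0 :=
  LinearMap.congr_fun (congrArg ModuleCat.Hom.hom (X.d_comp_d i j k)) x

theorem exactOnSystems_of_liftsAt {i j k : ℤ} (hi : i + 1 = j) (hk : j + 1 = k)
    (h : ∀ P : ModuleCat.{u} R, IsPureProjective P → LiftsAt P X j) :
    ExactOnSystems (X.d i j).hom (X.d j k).hom := by
  rw [exactOnSystems_iff_liftsSystems_codRestrict (d_hom_apply_d_hom_apply X i j k),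
    liftsSystems_iff_forall_isPureProjective]
  intro P hP f
  obtain ⟨l, hl⟩ := h P hP i k hi hk (ModuleCat.ofHom ((LinearMap.ker (X.d j k).hom).subtype ∘ₗ f))
    (ModuleCat.hom_ext (LinearMap.ext fun x => (f x).2))
  exact ⟨l.hom, LinearMap.ext fun x =>
    Subtype.ext (LinearMap.congr_fun (congrArg ModuleCat.Hom.hom hl) x)⟩

theorem exact_of_extendsAt {i j k : ℤ} (hi : i + 1 = j) (hk : j + 1 = k)
    (h : ∀ E : ModuleCat.{u} R, IsPureInjective E → ExtendsAt E X j) :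
    Function.Exact (X.d i j) (X.d j k) := by
  refine fun x => ⟨fun hx => ?_, ?_⟩
  · obtain ⟨E, f, hE, hf⟩ :=
      exists_pureInjective_embedding (R := R) (X.X j ⧸ LinearMap.range (X.d i j).hom)
    obtain ⟨l, hl⟩ := h E hE i k hi hk
      (ModuleCat.ofHom (f ∘ₗ (LinearMap.range (X.d i j).hom).mkQ)) (ModuleCat.hom_ext (by
        simp [LinearMap.comp_assoc, LinearMap.range_mkQ_comp]))
    have : f ((LinearMap.range (X.d i j).hom).mkQ x) = 0 := by
      refine (LinearMap.congr_fun (congrArg ModuleCat.Hom.hom hl) x).symm.trans ?_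
      exact (congrArg l hx).trans (map_zero l.hom)
    simpa using hf.injective (this.trans (map_zero f).symm)
  · rintro ⟨y, rfl⟩
    exact d_hom_apply_d_hom_apply X i j k y

theorem solvesSystems_ker_of_extendsAt {i j k l : ℤ} (hi : i + 1 = j) (hk : j + 1 = k)
    (hl : k + 1 = l)
    (h : ∀ (m : ℤ) (E : ModuleCat.{u} R), IsPureInjective E → ExtendsAt E X m) :
    SolvesSystems (LinearMap.ker (X.d k l).hom).subtype := by
  rw [solvesSystems_iff_forall_isPureInjective]
  intro E hE f
  let p := (X.d j k).hom.codRestrict (LinearMap.ker (X.d k l).hom) (d_hom_apply_d_hom_apply X j k l)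
  obtain ⟨g, hg⟩ := h j E hE i k hi hk (ModuleCat.ofHom (f ∘ₗ p)) (ModuleCat.hom_ext
    (LinearMap.ext fun x => (congrArg f (Subtype.ext (d_hom_apply_d_hom_apply X i j k x))).trans
      (map_zero f)))
  refine ⟨g.hom, LinearMap.ext fun ⟨x, hx⟩ => ?_⟩
  obtain ⟨y, rfl⟩ := (exact_of_extendsAt hk hl (h k) x).1 hx
  exact LinearMap.congr_fun (congrArg ModuleCat.Hom.hom hg) y

theorem pureExact_iff_exactOnSystems : PureExact X ↔
    ∀ i j k, i + 1 = j → j + 1 = k → ExactOnSystems (X.d i j).hom (X.d j k).hom := by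
  refine ⟨fun h i j k hi hk => exactOnSystems_of_liftsAt hi hk fun _ hP => (h j).liftsAt hP,
    fun h n => ?_⟩
  exact isPureExactPair_of_exactOnSystems (d_hom_apply_d_hom_apply X _ _ _)
    (d_hom_apply_d_hom_apply X _ _ (n + 1 + 1)) (d_hom_apply_d_hom_apply X _ _ (n + 1 + 1 + 1))
    (h _ _ _ (by lia) rfl) (h _ _ _ rfl rfl) (h _ _ _ rfl rfl)

variable (X) in
theorem pureExact_iff_liftsAt :
    PureExact X ↔ ∀ P : ModuleCat.{u} R, IsPureProjective P → ∀ n, LiftsAt P X n :=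
  ⟨fun h _ hP n => (h n).liftsAt hP, fun h => pureExact_iff_exactOnSystems.2
    fun _ j _ hi hk => exactOnSystems_of_liftsAt hi hk fun P hP => h P hP j⟩

variable (X) in
theorem pureExact_iff_extendsAt :
    PureExact X ↔ ∀ E : ModuleCat.{u} R, IsPureInjective E → ∀ n, ExtendsAt E X n := by
  refine ⟨fun h _ hE n => (h n).extendsAt hE, fun h => pureExact_iff_exactOnSystems.2
    fun i j k hi hk => ?_⟩
  replace h (m : ℤ) (E : ModuleCat.{u} R) (hE : IsPureInjective E) := h E hE m
  exact (exactOnSystems_iff_solvesSystems_subtype (d_hom_apply_d_hom_apply X i j k)).2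
    ⟨exact_of_extendsAt hi hk (h j),
      solvesSystems_ker_of_extendsAt (i := i - 2) (j := i - 1) (by lia) (by lia) hi h⟩

end Complexes

section Orthogonal

open Pretriangulated

variable {𝒯 : Type*} [Category* 𝒯] [HasZeroObject 𝒯] [HasShift 𝒯 ℤ] [Preadditive 𝒯]
  [∀ n : ℤ, (shiftFunctor 𝒯 n).Additive] [Pretriangulated 𝒯] {N : ObjectProperty 𝒯}
  [N.IsStableUnderShift ℤ] {X Y : 𝒯} {f : X ⟶ Y}

theorem isIso_of_trW_of_leftOrthogonal (hX : N.leftOrthogonal X) (hY : N.leftOrthogonal Y)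
    (hf : N.trW f) : IsIso f := by
  obtain ⟨Z, g, h, hT, hZ⟩ := hf
  refine (Triangle.isZero₃_iff_isIso₁ _ hT).1 ((IsZero.iff_id_eq_zero Z).2 ?_)
  exact (N.leftOrthogonal.ext_of_isTriangulatedClosed₃ _ hT hX hY) _ hZ

theorem isIso_of_trW_of_rightOrthogonal (hX : N.rightOrthogonal X) (hY : N.rightOrthogonal Y)
    (hf : N.trW f) : IsIso f := by
  obtain ⟨Z, g, h, hT, hZ⟩ := hf
  refine (Triangle.isZero₃_iff_isIso₁ _ hT).1 ((IsZero.iff_id_eq_zero Z).2 ?_)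
  exact (N.rightOrthogonal.ext_of_isTriangulatedClosed₃ _ hT hX hY) _ hZ

end Orthogonal

section Homotopy

open CochainComplex CochainComplex.HomComplex Pretriangulated

variable {R : Type u} [Ring R]

/-- The quotient functor to the homotopy category. -/
abbrev toHtpy (R : Type u) [Ring R] :
    CochainComplex (ModuleCat.{u} R) ℤ ⥤ HomotopyCategory (ModuleCat.{u} R) (ComplexShape.up ℤ) :=
  HomotopyCategory.quotient _ _

/-- The module `M` as a complex concentrated in degree `0`. -/
abbrev single₀ (M : ModuleCat.{u} R) : CochainComplex (ModuleCat.{u} R) ℤ :=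
  (CochainComplex.singleFunctor (ModuleCat.{u} R) 0).obj M

/-- The cohomology of `Hom_R(X, Y)` vanishes in degree `n`. -/
def HomVanishes (X Y : CochainComplex (ModuleCat.{u} R) ℤ) (n : ℤ) : Prop :=
  ∀ z : Cocycle X Y n, z ∈ coboundaries X Y n

section

variable {X Y : CochainComplex (ModuleCat.{u} R) ℤ} {n : ℤ}

theorem homVanishes_iff_cohomologyClass_eq_zero :
    HomVanishes X Y n ↔ ∀ x : CohomologyClass X Y n, x = 0 := by
  constructor
  · intro h x
    obtain ⟨z, rfl⟩ := x.mk_surjective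
    exact (CohomologyClass.mk_eq_zero_iff z).2 (h z)
  · intro h z
    exact (CohomologyClass.mk_eq_zero_iff z).1 (h _)

theorem homVanishes_iff_isZero : HomVanishes X Y n ↔ IsZero ((HomComplex X Y).homology n) := by
  rw [homVanishes_iff_cohomologyClass_eq_zero]
  constructor
  · intro h
    have : Subsingleton ((HomComplex X Y).homology n) :=
      ⟨fun a b => (homologyAddEquiv X Y n).injective ((h _).trans (h _).symm)⟩
    exact AddCommGrpCat.isZero_of_subsingleton _
  · intro h x
    have := AddCommGrpCat.subsingleton_of_isZero h
    rw [← (homologyAddEquiv X Y n).apply_symm_apply x,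
      Subsingleton.elim ((homologyAddEquiv X Y n).symm x) 0, map_zero]

theorem homVanishes_iff_hom :
    HomVanishes X Y n ↔ ∀ f : (toHtpy R).obj X ⟶ ((toHtpy R).obj Y)⟦n⟧, f = 0 := by
  rw [homVanishes_iff_cohomologyClass_eq_zero]
  let e := ((toHtpy R).commShiftIso n).app Y
  constructor
  · intro h f
    obtain ⟨x, hx⟩ := (CohomologyClass.toHom_bijective X Y n).surjective (f ≫ e.inv)
    rw [h x, map_zero] at hx
    rw [← cancel_mono e.inv, ← hx, zero_comp]
  · intro h x
    refine (CohomologyClass.toHom_bijective X Y n).injective ?_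
    rw [map_zero, ← cancel_mono e.hom, zero_comp]
    exact h _

theorem homVanishes_single_left (M : ModuleCat.{u} R) :
    HomVanishes (single₀ M) Y n ↔ LiftsAt M Y n := by
  constructor
  · intro h i k hi hk f hf
    exact (Cocycle.fromSingleMk_mem_coboundaries_iff f (zero_add n) k hk hf i hi).1 (h _)
  · intro h z
    obtain ⟨f, hf, rfl⟩ := Cocycle.fromSingleMk_surjective z n (zero_add n) (n + 1) rfl
    exact (Cocycle.fromSingleMk_mem_coboundaries_iff f (zero_add n) _ rfl hf (n - 1) (by lia)).2
      (h _ _ (by lia) rfl f hf)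

theorem homVanishes_single_right (M : ModuleCat.{u} R) {m : ℤ} (hm : m + n = 0) :
    HomVanishes X (single₀ M) n ↔ ExtendsAt M X m := by
  constructor
  · intro h i k hi hk f hf
    exact (Cocycle.toSingleMk_mem_coboundaries_iff f hm i hi hf k hk).1 (h _)
  · intro h z
    obtain ⟨f, hf, rfl⟩ := Cocycle.toSingleMk_surjective z m hm (m - 1) (by lia)
    exact (Cocycle.toSingleMk_mem_coboundaries_iff f hm _ (by lia) hf (m + 1) rfl).2
      (h _ _ (by lia) rfl f hf)

end

/-- The shifts of the pure projective modules, in the homotopy category. -/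
def pureProjectiveShifts (R : Type u) [Ring R] :
    ObjectProperty (HomotopyCategory (ModuleCat.{u} R) (ComplexShape.up ℤ)) :=
  fun A => ∃ (P : ModuleCat.{u} R) (i : ℤ), IsPureProjective P ∧
    Nonempty (A ≅ ((toHtpy R).obj (single₀ P))⟦i⟧)

instance : (pureProjectiveShifts R).IsStableUnderShift ℤ where
  isStableUnderShiftBy n := ⟨by
    rintro A ⟨P, i, hP, ⟨e⟩⟩
    exact ⟨P, i + n, hP,
      ⟨(CategoryTheory.shiftFunctor _ n).mapIso e ≪≫ ((shiftFunctorAdd _ i n).app _).symm⟩⟩⟩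

/-- The pure exact complexes, as a full subcategory of the homotopy category. Encoded as the right
orthogonal of the shifted pure projective modules, it is triangulated by construction. -/
abbrev pureAcyclic (R : Type u) [Ring R] :
    ObjectProperty (HomotopyCategory (ModuleCat.{u} R) (ComplexShape.up ℤ)) :=
  (pureProjectiveShifts R).rightOrthogonal

theorem pureAcyclic_iff (X : CochainComplex (ModuleCat.{u} R) ℤ) :
    pureAcyclic R ((toHtpy R).obj X) ↔ PureExact X := by
  rw [pureExact_iff_liftsAt]
  simp_rw [← homVanishes_single_left, homVanishes_iff_hom]
  constructor
  · intro h P hP n f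
    refine (CategoryTheory.shiftFunctor _ (-n)).map_injective ?_
    rw [Functor.map_zero, ← cancel_mono (shiftShiftNeg ((toHtpy R).obj X) n).hom, zero_comp]
    exact h _ ⟨P, -n, hP, ⟨Iso.refl _⟩⟩
  · rintro h A f ⟨P, n, hP, ⟨e⟩⟩
    rw [← cancel_epi e.inv, comp_zero]
    refine (CategoryTheory.shiftFunctor _ (-n)).map_injective ?_
    rw [Functor.map_zero, ← cancel_epi (shiftShiftNeg ((toHtpy R).obj (single₀ P)) n).inv,
      comp_zero]
    exact h P hP (-n) _

theorem trW_pureAcyclic_iff {X Y : CochainComplex (ModuleCat.{u} R) ℤ} (f : X ⟶ Y) :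
    (pureAcyclic R).trW ((toHtpy R).map f) ↔ IsPureQuasiIso f := by
  rw [IsPureQuasiIso, ← pureAcyclic_iff]
  exact (pureAcyclic R).trW_iff_of_distinguished _
    (HomotopyCategory.mappingCone_triangleh_distinguished f)

/-- Every map from `P` to a pure exact complex is null-homotopic. -/
def IsKPureProjective (P : CochainComplex (ModuleCat.{u} R) ℤ) : Prop :=
  (pureAcyclic R).leftOrthogonal ((toHtpy R).obj P)

/-- Every map from a pure exact complex to `I` is null-homotopic. -/
def IsKPureInjective (I : CochainComplex (ModuleCat.{u} R) ℤ) : Prop :=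
  (pureAcyclic R).rightOrthogonal ((toHtpy R).obj I)

theorem isKPureProjective_of_homotopy {P : CochainComplex (ModuleCat.{u} R) ℤ}
    (h : ∀ (Z : CochainComplex (ModuleCat.{u} R) ℤ) (f : P ⟶ Z), PureExact Z →
      Nonempty (Homotopy f 0)) : IsKPureProjective P := by
  intro Z f hZ
  obtain ⟨Z, rfl⟩ := HomotopyCategory.quotient_obj_surjective Z
  obtain ⟨f, rfl⟩ := (toHtpy R).map_surjective f
  exact (HomotopyCategory.quotient_map_eq_zero_iff f).2 (h Z f ((pureAcyclic_iff Z).1 hZ))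

theorem isKPureInjective_of_homotopy {I : CochainComplex (ModuleCat.{u} R) ℤ}
    (h : ∀ (Z : CochainComplex (ModuleCat.{u} R) ℤ) (f : Z ⟶ I), PureExact Z →
      Nonempty (Homotopy f 0)) : IsKPureInjective I := by
  intro Z f hZ
  obtain ⟨Z, rfl⟩ := HomotopyCategory.quotient_obj_surjective Z
  obtain ⟨f, rfl⟩ := (toHtpy R).map_surjective f
  exact (HomotopyCategory.quotient_map_eq_zero_iff f).2 (h Z f ((pureAcyclic_iff Z).1 hZ))

variable {X X' Y Y' P P' I I' : CochainComplex (ModuleCat.{u} R) ℤ}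

theorem IsKPureProjective.homVanishes (hP : IsKPureProjective P) (hY : PureExact Y) (n : ℤ) :
    HomVanishes P Y n :=
  homVanishes_iff_hom.2 fun f => hP f
    ((pureAcyclic R).le_shift n _ ((pureAcyclic_iff Y).2 hY))

theorem IsKPureInjective.homVanishes (hI : IsKPureInjective I) (hX : PureExact X) (n : ℤ) :
    HomVanishes X I n :=
  homVanishes_iff_hom.2 fun f => ((pureAcyclic R).rightOrthogonal.le_shift n _ hI) f
    ((pureAcyclic_iff X).2 hX)

theorem isKPureProjective_of_homVanishes
    (h : ∀ Z : CochainComplex (ModuleCat.{u} R) ℤ, PureExact Z → HomVanishes P Z 0) :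
    IsKPureProjective P := by
  intro Z f hZ
  obtain ⟨Z, rfl⟩ := HomotopyCategory.quotient_obj_surjective Z
  let e := (shiftFunctorZero _ ℤ).app ((toHtpy R).obj Z)
  rw [← cancel_mono e.inv, zero_comp]
  exact homVanishes_iff_hom.1 (h Z ((pureAcyclic_iff Z).1 hZ)) _

theorem isKPureInjective_of_homVanishes
    (h : ∀ Z : CochainComplex (ModuleCat.{u} R) ℤ, PureExact Z → HomVanishes Z I 0) :
    IsKPureInjective I := by
  intro Z f hZ
  obtain ⟨Z, rfl⟩ := HomotopyCategory.quotient_obj_surjective Z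
  let e := (shiftFunctorZero _ ℤ).app ((toHtpy R).obj I)
  rw [← cancel_mono e.inv, zero_comp]
  exact homVanishes_iff_hom.1 (h Z ((pureAcyclic_iff Z).1 hZ)) _

theorem IsKPureProjective.homVanishes_iff (hP : IsKPureProjective P) {f : Y ⟶ Y'}
    (hf : IsPureQuasiIso f) (n : ℤ) : HomVanishes P Y n ↔ HomVanishes P Y' n := by
  have h : (pureAcyclic R).trW.isColocal ((toHtpy R).obj P) := by
    rw [ObjectProperty.isColocal_trW]
    exact hP
  have hb := h _ (((trW_pureAcyclic_iff f).2 hf).shift n)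
  rw [homVanishes_iff_hom, homVanishes_iff_hom]
  constructor
  · intro H g
    obtain ⟨k, rfl⟩ := hb.surjective g
    simp [H k]
  · intro H g
    exact hb.injective ((H _).trans (H _).symm)

theorem IsKPureInjective.homVanishes_iff (hI : IsKPureInjective I) {f : X ⟶ X'}
    (hf : IsPureQuasiIso f) (n : ℤ) : HomVanishes X I n ↔ HomVanishes X' I n := by
  have h : (pureAcyclic R).trW.isLocal (((toHtpy R).obj I)⟦n⟧) := by
    rw [ObjectProperty.isLocal_trW]
    exact (pureAcyclic R).rightOrthogonal.le_shift n _ hI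
  have hb := h _ ((trW_pureAcyclic_iff f).2 hf)
  rw [homVanishes_iff_hom, homVanishes_iff_hom]
  constructor
  · intro H g
    exact hb.injective ((H _).trans (H _).symm)
  · intro H g
    obtain ⟨k, rfl⟩ := hb.surjective g
    simp [H k]

theorem IsKPureProjective.exists_pureQuasiIso {π : P ⟶ X} {f : P ⟶ P'}
    (hP : IsKPureProjective P) (hP' : IsKPureProjective P') (hπ : IsPureQuasiIso π)
    (hf : IsPureQuasiIso f) : ∃ π' : P' ⟶ X, IsPureQuasiIso π' := by
  have := isIso_of_trW_of_leftOrthogonal hP hP' ((trW_pureAcyclic_iff f).2 hf)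
  obtain ⟨g, hg⟩ := (toHtpy R).map_surjective (inv ((toHtpy R).map f) ≫ (toHtpy R).map π)
  refine ⟨g, ?_⟩
  rw [← trW_pureAcyclic_iff, hg]
  exact ((pureAcyclic R).trW.cancel_left_of_respectsIso _ _).2 ((trW_pureAcyclic_iff π).2 hπ)

theorem IsKPureInjective.exists_pureQuasiIso {ι : Y ⟶ I} {f : I' ⟶ I}
    (hI : IsKPureInjective I) (hI' : IsKPureInjective I') (hι : IsPureQuasiIso ι)
    (hf : IsPureQuasiIso f) : ∃ ι' : Y ⟶ I', IsPureQuasiIso ι' := by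
  have := isIso_of_trW_of_rightOrthogonal hI' hI ((trW_pureAcyclic_iff f).2 hf)
  obtain ⟨g, hg⟩ := (toHtpy R).map_surjective ((toHtpy R).map ι ≫ inv ((toHtpy R).map f))
  refine ⟨g, ?_⟩
  rw [← trW_pureAcyclic_iff, hg]
  exact ((pureAcyclic R).trW.cancel_right_of_respectsIso _ _).2 ((trW_pureAcyclic_iff ι).2 hι)

end Homotopy

section Cone

open CochainComplex

variable {R : Type u} [Ring R] {X Y : CochainComplex (ModuleCat.{u} R) ℤ}

theorem liftsAt_mappingCone (f : X ⟶ Y) (P : ModuleCat.{u} R) (i n k m : ℤ) (hi : i + 1 = n)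
    (hk : n + 1 = k) (hm : k + 1 = m)
    (H : ∀ (x : P ⟶ X.X k) (y : P ⟶ Y.X n), x ≫ X.d k m = 0 → x ≫ f.f k + y ≫ Y.d n k = 0 →
      ∃ (x' : P ⟶ X.X n) (y' : P ⟶ Y.X i), x' ≫ X.d n k = -x ∧ x' ≫ f.f n + y' ≫ Y.d i n = y) :
    LiftsAt P (mappingCone f) n := by
  intro i' k' hi' hk' h hd
  obtain rfl : i' = i := by lia
  obtain rfl : k' = k := by lia
  obtain ⟨x', y', hx, hy⟩ := H (h ≫ (mappingCone.fst f).1.v n k' hk)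
    (h ≫ (mappingCone.snd f).v n n (add_zero n))
    (by
      have := hd =≫ (mappingCone.fst f).1.v k' m hm
      rw [Category.assoc, mappingCone.d_fst_v f n k' m hk hm, zero_comp, Preadditive.comp_neg,
        neg_eq_zero, ← Category.assoc] at this
      exact this)
    (by
      have := hd =≫ (mappingCone.snd f).v k' k' (add_zero k')
      rw [Category.assoc, mappingCone.d_snd_v f n k' hk, zero_comp, Preadditive.comp_add] at this
      simpa only [Category.assoc] using this)
  refine ⟨x' ≫ (mappingCone.inl f).v n i' (by lia) + y' ≫ (mappingCone.inr f).f i', ?_⟩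
  rw [Preadditive.add_comp, Category.assoc, Category.assoc,
    mappingCone.inl_v_d f n i' k' (by lia) (by lia), mappingCone.inr_f_d,
    mappingCone.ext_to_iff f n k' hk]
  constructor
  · simp [hx]
  · simpa using hy

theorem extendsAt_mappingCone (f : X ⟶ Y) (E : ModuleCat.{u} R) (i n k m : ℤ) (hi : i + 1 = n)
    (hk : n + 1 = k) (hm : k + 1 = m)
    (H : ∀ (x : X.X k ⟶ E) (y : Y.X n ⟶ E), Y.d i n ≫ y = 0 → f.f n ≫ y = X.d n k ≫ x →
      ∃ (x' : X.X m ⟶ E) (y' : Y.X k ⟶ E), Y.d n k ≫ y' = y ∧ f.f k ≫ y' - X.d k m ≫ x' = x) :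
    ExtendsAt E (mappingCone f) n := by
  intro i' k' hi' hk' h hd
  obtain rfl : i' = i := by lia
  obtain rfl : k' = k := by lia
  obtain ⟨x', y', hy, hx⟩ := H ((mappingCone.inl f).v k' n (by lia) ≫ h)
    ((mappingCone.inr f).f n ≫ h)
    (by rw [← mappingCone.inr_f_d_assoc, hd, comp_zero])
    (by
      have := (mappingCone.inl f).v n i' (by lia) ≫= hd
      rw [← Category.assoc, mappingCone.inl_v_d f n i' k' (by lia) (by lia), comp_zero,
        Preadditive.sub_comp, Category.assoc, Category.assoc, sub_eq_zero] at this
      exact this)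
  refine ⟨(mappingCone.fst f).1.v k' m hm ≫ x' +
    (mappingCone.snd f).v k' k' (add_zero k') ≫ y', ?_⟩
  rw [Preadditive.comp_add, ← Category.assoc, ← Category.assoc,
    mappingCone.d_fst_v f n k' m hk hm, mappingCone.d_snd_v f n k' hk,
    mappingCone.ext_from_iff f k' n hk]
  constructor
  · simp only [Preadditive.comp_add, Preadditive.add_comp, Preadditive.neg_comp,
      Preadditive.comp_neg, Category.assoc, mappingCone.inl_v_fst_v_assoc,
      mappingCone.inl_v_snd_v_assoc, zero_comp, add_zero]
    rw [← hx]
    abel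
  · simpa using hy

end Cone

section Subquotients

variable {R : Type u} [Ring R] (X : CochainComplex (ModuleCat.{u} R) ℤ)
  (K : ∀ i, Submodule R (X.X i)) (hK : ∀ i j, ∀ x ∈ K i, (X.d i j).hom x ∈ K j)

/-- The subcomplex given by a family of submodules stable under the differential. -/
def subcomplex : CochainComplex (ModuleCat.{u} R) ℤ where
  X i := ModuleCat.of R (K i)
  d i j := ModuleCat.ofHom ((X.d i j).hom.restrict (hK i j))
  shape i j hij := by
    ext x
    change (X.d i j).hom x.1 = 0
    rw [X.shape i j hij]
    rfl
  d_comp_d' i j k _ _ := by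
    ext x
    exact d_hom_apply_d_hom_apply X i j k x.1

/-- The inclusion of a subcomplex. -/
def subcomplex.ι : subcomplex X K hK ⟶ X where
  f i := ModuleCat.ofHom (K i).subtype
  comm' _ _ _ := rfl

/-- The quotient complex by a family of submodules stable under the differential. -/
def quotientComplex : CochainComplex (ModuleCat.{u} R) ℤ where
  X i := ModuleCat.of R (X.X i ⧸ K i)
  d i j := ModuleCat.ofHom ((K i).mapQ (K j) (X.d i j).hom (hK i j))
  shape i j hij := by
    ext1
    refine Submodule.linearMap_qext _ (LinearMap.ext fun x => ?_)
    change (K j).mkQ ((X.d i j).hom x) = 0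
    rw [X.shape i j hij]
    exact map_zero _
  d_comp_d' i j k _ _ := by
    ext1
    refine Submodule.linearMap_qext _ (LinearMap.ext fun x => ?_)
    exact (congrArg (K k).mkQ (d_hom_apply_d_hom_apply X i j k x)).trans (map_zero _)

/-- The projection to a quotient complex. -/
def quotientComplex.π : X ⟶ quotientComplex X K hK where
  f i := ModuleCat.ofHom (K i).mkQ
  comm' _ _ _ := rfl

end Subquotients

section Truncation

variable {R : Type u} [Ring R] (X : CochainComplex (ModuleCat.{u} R) ℤ) (s : ℤ)

/-- The terms of the canonical truncation `τ_{≤ s} X`: all of `X i` for `i < s`, the cycles for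
`i = s`, and zero for `i > s`. -/
def truncLESubmodule (i : ℤ) : Submodule R (X.X i) :=
  (⨅ _ : s ≤ i, LinearMap.ker (X.d i (i + 1)).hom) ⊓ ⨅ _ : s < i, ⊥

theorem mem_truncLESubmodule {X : CochainComplex (ModuleCat.{u} R) ℤ} {s i : ℤ} {x : X.X i} :
    x ∈ truncLESubmodule X s i ↔ (s ≤ i → X.d i (i + 1) x = 0) ∧ (s < i → x = 0) := by
  simp [truncLESubmodule, Submodule.mem_iInf]

theorem truncLESubmodule_d (i j : ℤ) (x : X.X i) (hx : x ∈ truncLESubmodule X s i) :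
    (X.d i j).hom x ∈ truncLESubmodule X s j := by
  refine mem_truncLESubmodule.2 ⟨fun _ => d_hom_apply_d_hom_apply X i j (j + 1) x, fun h => ?_⟩
  by_cases hij : i + 1 = j
  · subst hij
    exact (mem_truncLESubmodule.1 hx).1 (by lia)
  · rw [X.shape i j hij]
    rfl

/-- The canonical truncation `τ_{≤ s} X`. -/
abbrev truncLE : CochainComplex (ModuleCat.{u} R) ℤ :=
  subcomplex X (truncLESubmodule X s) (truncLESubmodule_d X s)

/-- The inclusion of `τ_{≤ s} X` in `X`. -/
abbrev truncLE.ι : truncLE X s ⟶ X := subcomplex.ι _ _ _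

/-- The terms of the kernel of `X ⟶ τ_{≥ s} X`: all of `X i` for `i < s`, the boundaries for
`i = s`, and zero for `i > s`. -/
def truncGESubmodule (i : ℤ) : Submodule R (X.X i) :=
  if i < s then ⊤ else if i = s then LinearMap.range (X.d (i - 1) i).hom else ⊥

theorem truncGESubmodule_d (i j : ℤ) (x : X.X i) (hx : x ∈ truncGESubmodule X s i) :
    (X.d i j).hom x ∈ truncGESubmodule X s j := by
  by_cases hij : i + 1 = j
  · obtain rfl : i = j - 1 := by lia
    by_cases h₁ : j < s
    · simp [truncGESubmodule, h₁]
    by_cases h₂ : j = s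
    · simp [truncGESubmodule, h₂]
    · rw [truncGESubmodule, if_neg (by lia)] at hx
      suffices (X.d (j - 1) j).hom x = 0 by
        rw [this]
        exact zero_mem _
      split_ifs at hx
      · obtain ⟨y, rfl⟩ := hx
        exact d_hom_apply_d_hom_apply X _ _ _ y
      · rw [(Submodule.mem_bot _).1 hx, map_zero]
  · rw [X.shape i j hij]
    exact zero_mem _

/-- The canonical truncation `τ_{≥ s} X`. -/
abbrev truncGE : CochainComplex (ModuleCat.{u} R) ℤ :=
  quotientComplex X (truncGESubmodule X s) (truncGESubmodule_d X s)

/-- The projection of `X` to `τ_{≥ s} X`. -/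
abbrev truncGE.π : X ⟶ truncGE X s := quotientComplex.π _ _ _

variable {X s}

theorem isZero_truncLE {i : ℤ} (h : s < i) : IsZero ((truncLE X s).X i) := by
  have : Subsingleton (truncLESubmodule X s i) :=
    ⟨fun x y => Subtype.ext
      (((mem_truncLESubmodule.1 x.2).2 h).trans ((mem_truncLESubmodule.1 y.2).2 h).symm)⟩
  exact ModuleCat.isZero_of_subsingleton (ModuleCat.of R (truncLESubmodule X s i))

theorem isZero_truncGE {i : ℤ} (h : i < s) : IsZero ((truncGE X s).X i) := by
  have : Subsingleton (X.X i ⧸ truncGESubmodule X s i) := by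
    rw [Submodule.Quotient.subsingleton_iff, truncGESubmodule, if_pos h]
  exact ModuleCat.isZero_of_subsingleton (ModuleCat.of R (X.X i ⧸ truncGESubmodule X s i))

theorem isPureQuasiIso_truncLE (h : ∀ P : ModuleCat.{u} R, IsPureProjective P →
    ∀ n, s < n → LiftsAt P X n) : IsPureQuasiIso (truncLE.ι X s) := by
  refine (pureExact_iff_liftsAt _).2 fun P hP n =>
    liftsAt_mappingCone _ P (n - 1) n (n + 1) (n + 2) (by lia) rfl (by lia) ?_
  intro x y hx hxy
  by_cases hn : s < n
  · have hx0 : x = 0 := (isZero_truncLE (X := X) (by lia : s < n + 1)).eq_of_tgt _ _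
    subst hx0
    rw [zero_comp, zero_add] at hxy
    obtain ⟨l, hl⟩ := h P hP n hn (n - 1) (n + 1) (by lia) rfl y hxy
    exact ⟨0, l, by simp, by simp [hl]⟩
  · have hy (p : P) : y.hom p ∈ truncLESubmodule X s n := by
      refine mem_truncLESubmodule.2 ⟨fun hs => ?_, fun hs => absurd hs hn⟩
      have hx0 : x = 0 := (isZero_truncLE (X := X) (by lia : s < n + 1)).eq_of_tgt _ _
      subst hx0
      rw [zero_comp, zero_add] at hxy
      exact LinearMap.congr_fun (congrArg ModuleCat.Hom.hom hxy) p
    refine ⟨ModuleCat.ofHom (y.hom.codRestrict _ hy), 0, ?_, ?_⟩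
    · ext p
      refine Subtype.ext ?_
      have := LinearMap.congr_fun (congrArg ModuleCat.Hom.hom hxy) p
      exact eq_neg_of_add_eq_zero_right this
    · rw [zero_comp, add_zero]
      rfl

theorem isPureQuasiIso_truncGE (h : ∀ E : ModuleCat.{u} R, IsPureInjective E →
    ∀ n, n < s → ExtendsAt E X n) : IsPureQuasiIso (truncGE.π X s) := by
  refine (pureExact_iff_extendsAt _).2 fun E hE n =>
    extendsAt_mappingCone _ E (n - 1) n (n + 1) (n + 2) (by lia) rfl (by lia) ?_
  intro x y hy hxy
  by_cases hn : n + 1 < s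
  · have hy0 : y = 0 := (isZero_truncGE (X := X) (by lia : n < s)).eq_of_src _ _
    subst hy0
    rw [comp_zero] at hxy
    obtain ⟨l, hl⟩ := h E hE (n + 1) hn n (n + 2) rfl (by lia) x hxy.symm
    exact ⟨-l, 0, by simp, by simp [hl]⟩
  · have hx : truncGESubmodule X s (n + 1) ≤ LinearMap.ker x.hom := by
      rw [truncGESubmodule, if_neg hn]
      split_ifs with hs
      · have hy0 : y = 0 := (isZero_truncGE (X := X) (by lia : n < s)).eq_of_src _ _
        subst hy0
        rw [comp_zero] at hxy
        have x_d : ∀ m, m = n → ∀ z : X.X m, x.hom ((X.d m (n + 1)).hom z) = 0 := by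
          rintro _ rfl z
          exact (LinearMap.congr_fun (congrArg ModuleCat.Hom.hom hxy) z).symm
        rintro _ ⟨z, rfl⟩
        exact x_d _ (by lia) z
      · exact bot_le
    let l : (truncGE X s).X (n + 1) ⟶ E := ModuleCat.ofHom (Submodule.liftQ _ x.hom hx)
    have hl : (truncGE.π X s).f (n + 1) ≫ l = x := by
      ext1
      exact Submodule.liftQ_mkQ _ _ _
    refine ⟨0, l, ?_, by simp [hl]⟩
    have hepi : Epi ((truncGE.π X s).f n) :=
      (ModuleCat.epi_iff_surjective _).2 (Submodule.mkQ_surjective _)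
    rw [← cancel_epi ((truncGE.π X s).f n), HomologicalComplex.Hom.comm_assoc, hl, hxy]

end Truncation

section TruncationTerms

variable {R : Type u} [Ring R] {X : CochainComplex (ModuleCat.{u} R) ℤ} {s : ℤ}

theorem truncLESubmodule_eq_top {i : ℤ} (hi : i < s) : truncLESubmodule X s i = ⊤ := by
  simp [truncLESubmodule, hi.not_ge, hi.not_gt]

theorem truncLESubmodule_self : truncLESubmodule X s s = LinearMap.ker (X.d s (s + 1)).hom := by
  simp [truncLESubmodule]

theorem truncGESubmodule_self : truncGESubmodule X s s = LinearMap.range (X.d (s - 1) s).hom := by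
  simp [truncGESubmodule]

theorem truncGESubmodule_eq_bot {i : ℤ} (hi : s < i) : truncGESubmodule X s i = ⊥ := by
  rw [truncGESubmodule, if_neg hi.not_gt, if_neg hi.ne']

theorem exists_comp_subtype_truncLESubmodule_self (h : ∀ M : ModuleCat.{u} R, LiftsAt M X (s + 1)) :
    ∃ p : X.X s →ₗ[R] truncLESubmodule X s s,
      p ∘ₗ (truncLESubmodule X s s).subtype = LinearMap.id := by
  let d := (X.d s (s + 1)).hom.codRestrict (LinearMap.ker (X.d (s + 1) (s + 2)).hom)
    (d_hom_apply_d_hom_apply X _ _ _)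
  obtain ⟨σ, hσ⟩ := h (ModuleCat.of R (LinearMap.ker (X.d (s + 1) (s + 2)).hom)) s (s + 2) rfl
    (by lia) (ModuleCat.ofHom (Submodule.subtype _)) (ModuleCat.hom_ext
      (LinearMap.ext fun x => x.2))
  have d_σ (z : LinearMap.ker (X.d (s + 1) (s + 2)).hom) : X.d s (s + 1) (σ.hom z) = z.1 :=
    LinearMap.congr_fun (congrArg ModuleCat.Hom.hom hσ) z
  let p : X.X s →ₗ[R] X.X s := LinearMap.id - σ.hom ∘ₗ d
  have p_mem (x : X.X s) : p x ∈ truncLESubmodule X s s := by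
    rw [truncLESubmodule_self]
    exact (map_sub (X.d s (s + 1)).hom _ _).trans (sub_eq_zero.2 (d_σ (d x)).symm)
  refine ⟨p.codRestrict _ p_mem, LinearMap.ext fun x => Subtype.ext ?_⟩
  have d_x : d x.1 = 0 := Subtype.ext ((mem_truncLESubmodule.1 x.2).1 le_rfl)
  simp [p, d_x]

theorem exists_mkQ_comp_truncGESubmodule_self (h : ∀ M : ModuleCat.{u} R, ExtendsAt M X (s - 1)) :
    ∃ i : (X.X s ⧸ truncGESubmodule X s s) →ₗ[R] X.X s,
      (truncGESubmodule X s s).mkQ ∘ₗ i = LinearMap.id := by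
  let d := (LinearMap.range (X.d (s - 2) (s - 1)).hom).liftQ (X.d (s - 1) s).hom (by
    rintro _ ⟨x, rfl⟩
    exact d_hom_apply_d_hom_apply X _ _ _ x)
  obtain ⟨ρ, hρ⟩ := h (ModuleCat.of R (X.X (s - 1) ⧸ LinearMap.range (X.d (s - 2) (s - 1)).hom))
    (s - 2) s (by lia) (by lia) (ModuleCat.ofHom (Submodule.mkQ _))
    (ModuleCat.hom_ext (LinearMap.range_mkQ_comp _))
  have ρ_d (x : X.X (s - 1)) : ρ.hom (X.d (s - 1) s x) = Submodule.Quotient.mk x :=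
    LinearMap.congr_fun (congrArg ModuleCat.Hom.hom hρ) x
  have d_mem (z) : d z ∈ truncGESubmodule X s s := by
    obtain ⟨x, rfl⟩ := Submodule.Quotient.mk_surjective _ z
    rw [truncGESubmodule_self]
    exact ⟨x, rfl⟩
  refine ⟨Submodule.liftQ _ (LinearMap.id - d ∘ₗ ρ.hom) ?_, Submodule.linearMap_qext _
    (LinearMap.ext fun x => ?_)⟩
  · rw [truncGESubmodule_self]
    rintro _ ⟨x, rfl⟩
    exact sub_eq_zero.2 (congrArg d (ρ_d x)).symm
  · simpa using d_mem (ρ.hom x)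

theorem isPureInjective_truncLE (hX : ∀ i, IsPureInjective (X.X i))
    (h : ∀ M : ModuleCat.{u} R, LiftsAt M X (s + 1)) (i : ℤ) :
    IsPureInjective ((truncLE X s).X i) := by
  obtain hi | rfl | hi := lt_trichotomy i s
  · let e := LinearEquiv.ofTop _ (truncLESubmodule_eq_top (X := X) hi)
    exact (hX i).of_retract (i := e.toLinearMap) (p := e.symm.toLinearMap)
      (LinearMap.ext e.symm_apply_apply)
  · obtain ⟨p, hp⟩ := exists_comp_subtype_truncLESubmodule_self h
    exact (hX i).of_retract hp
  · have := ModuleCat.subsingleton_of_isZero (isZero_truncLE (X := X) hi)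
    exact isPureInjective_of_subsingleton _

theorem isPureProjective_truncGE (hX : ∀ i, IsPureProjective (X.X i))
    (h : ∀ M : ModuleCat.{u} R, ExtendsAt M X (s - 1)) (i : ℤ) :
    IsPureProjective ((truncGE X s).X i) := by
  obtain hi | rfl | hi := lt_trichotomy i s
  · have := ModuleCat.subsingleton_of_isZero (isZero_truncGE (X := X) hi)
    exact isPureProjective_of_subsingleton _
  · obtain ⟨j, hj⟩ := exists_mkQ_comp_truncGESubmodule_self h
    exact (hX i).of_retract hj
  · let e := Submodule.quotEquivOfEqBot _ (truncGESubmodule_eq_bot (X := X) hi)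
    exact (hX i).of_retract (i := e.toLinearMap) (p := e.symm.toLinearMap)
      (LinearMap.ext e.symm_apply_apply)

end TruncationTerms

section Recursion

variable {T : ℤ → Type w} (r : ∀ i j, T i → T j → Prop) (b : ℤ)

/-- The family obtained from `t₀` in degrees `> b` by a descending recursion. -/
def descendingFamily (t₀ : ∀ i, b < i → T i) (step : ∀ i, T (i + 1) → T i) (i : ℤ) : T i :=
  if h : b < i then t₀ i h else step i (descendingFamily t₀ step (i + 1))
termination_by (b + 1 - i).toNat
decreasing_by lia

/-- The family obtained from `t₀` in degrees `< b` by an ascending recursion. -/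
def ascendingFamily (t₀ : ∀ i, i < b → T i) (step : ∀ i j, i + 1 = j → T i → T j) (j : ℤ) : T j :=
  if h : j < b then t₀ j h else step (j - 1) j (by lia) (ascendingFamily t₀ step (j - 1))
termination_by (j - b + 1).toNat
decreasing_by lia

theorem exists_descendingFamily (t₀ : ∀ i, b < i → T i)
    (h₀ : ∀ i j (hij : i + 1 = j) (hi : b < i), r i j (t₀ i hi) (t₀ j (by lia)))
    (hs : ∀ i j, i + 1 = j → ∀ t : T j, ∃ s : T i, r i j s t) :
    ∃ S : ∀ i, T i, (∀ i (hi : b < i), S i = t₀ i hi) ∧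
      ∀ i j, i + 1 = j → r i j (S i) (S j) := by
  choose step hstep using fun i => hs i (i + 1) rfl
  refine ⟨descendingFamily b t₀ step, fun i hi => by rw [descendingFamily, dif_pos hi], ?_⟩
  rintro i _ rfl
  by_cases h : b < i
  · rw [descendingFamily, dif_pos h, descendingFamily, dif_pos (by lia)]
    exact h₀ _ _ rfl h
  · rw [descendingFamily, dif_neg h]
    exact hstep i _

theorem exists_ascendingFamily (t₀ : ∀ i, i < b → T i)
    (h₀ : ∀ i j (hij : i + 1 = j) (hj : j < b), r i j (t₀ i (by lia)) (t₀ j hj))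
    (hs : ∀ i j, i + 1 = j → ∀ s : T i, ∃ t : T j, r i j s t) :
    ∃ S : ∀ i, T i, (∀ i (hi : i < b), S i = t₀ i hi) ∧
      ∀ i j, i + 1 = j → r i j (S i) (S j) := by
  choose step hstep using hs
  refine ⟨ascendingFamily b t₀ step, fun i hi => by rw [ascendingFamily, dif_pos hi],
    fun i j hij => ?_⟩
  obtain rfl : i = j - 1 := by lia
  by_cases h : j < b
  · rw [ascendingFamily, dif_pos (by lia), ascendingFamily, dif_pos h]
    exact h₀ _ _ hij h
  · rw [ascendingFamily.eq_def _ _ _ j, dif_neg h]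
    exact hstep _ j hij _

end Recursion

section NullHomotopy

variable {R : Type u} [Ring R] {X Y : CochainComplex (ModuleCat.{u} R) ℤ}

theorem nonempty_homotopy_zero {f : X ⟶ Y} (s : ∀ i j, X.X i ⟶ Y.X j)
    (h₀ : ∀ i j, j + 1 ≠ i → s i j = 0)
    (h : ∀ i j k, i + 1 = j → j + 1 = k → s j i ≫ Y.d i j + X.d j k ≫ s k j = f.f j) :
    Nonempty (Homotopy f 0) :=
  ⟨{  hom := s
      zero := fun i j hij => h₀ i j hij
      comm := fun i => by
        rw [dNext_eq s (show (ComplexShape.up ℤ).Rel i (i + 1) from rfl),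
          prevD_eq s (show (ComplexShape.up ℤ).Rel (i - 1) i from by simp),
          HomologicalComplex.zero_f, add_zero, add_comm]
        exact (h (i - 1) i (i + 1) (by lia) rfl).symm }⟩

theorem isKPureProjective_of_bounded {P : CochainComplex (ModuleCat.{u} R) ℤ} {b : ℤ}
    (hb : ∀ i, b < i → IsZero (P.X i)) (hP : ∀ i, IsPureProjective (P.X i)) :
    IsKPureProjective P := by
  refine isKPureProjective_of_homotopy fun Z f hZ => ?_
  let T (i : ℤ) := {s : ∀ j, P.X i ⟶ Z.X j // (∀ j, j + 1 ≠ i → s j = 0) ∧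
    ∀ j, j + 1 = i → (f.f j - P.d j i ≫ s j) ≫ Z.d j i = 0}
  let r (i j : ℤ) (s : T i) (t : T j) : Prop :=
    ∀ k, k + 1 = i → s.1 k ≫ Z.d k i + P.d i j ≫ t.1 i = f.f i
  obtain ⟨S, -, hS⟩ := exists_descendingFamily r b (fun i h => ⟨fun _ => 0, fun _ _ => rfl,
      fun j _ => by
        rw [comp_zero, sub_zero, f.comm, (hb i h).eq_of_src (f.f i) 0, comp_zero]⟩)
    (fun i j hij hi k _ => (hb i hi).eq_of_src _ _) (by
      rintro i j hij ⟨t, ht₀, ht⟩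
      obtain ⟨l, hl⟩ := (hZ i).liftsAt (hP i) (i - 1) j (by lia) hij _ (ht i hij)
      refine ⟨⟨Pi.single (i - 1) l, fun k hk => Pi.single_eq_of_ne (by lia) _, fun k hk => ?_⟩,
        fun k hk => ?_⟩
      · obtain rfl : k = i - 1 := by lia
        rw [Pi.single_eq_same, Preadditive.sub_comp, Category.assoc, hl, f.comm,
          ← Preadditive.comp_sub, sub_sub_cancel, P.d_comp_d_assoc, zero_comp]
      · obtain rfl : k = i - 1 := by lia
        dsimp only
        rw [Pi.single_eq_same, hl, sub_add_cancel])
  exact nonempty_homotopy_zero (fun i j => (S i).1 j) (fun i j h => (S i).2.1 j h)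
    fun i j k hij hjk => hS j k hjk i hij

theorem isKPureInjective_of_bounded {I : CochainComplex (ModuleCat.{u} R) ℤ} {b : ℤ}
    (hb : ∀ i, i < b → IsZero (I.X i)) (hI : ∀ i, IsPureInjective (I.X i)) :
    IsKPureInjective I := by
  refine isKPureInjective_of_homotopy fun Z f hZ => ?_
  let T (i : ℤ) := {s : ∀ j, Z.X i ⟶ I.X j // (∀ j, j + 1 ≠ i → s j = 0) ∧
    ∀ j, j + 1 = i → Z.d j i ≫ (f.f i - s j ≫ I.d j i) = 0}
  let r (i j : ℤ) (s : T i) (t : T j) : Prop :=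
    ∀ k, k + 1 = i → s.1 k ≫ I.d k i + Z.d i j ≫ t.1 i = f.f i
  obtain ⟨S, -, hS⟩ := exists_ascendingFamily r b (fun i h => ⟨fun _ => 0, fun _ _ => rfl,
      fun j _ => (hb i h).eq_of_tgt _ _⟩)
    (fun i j hij hj k _ => (hb i (by lia)).eq_of_tgt _ _) (by
      rintro i j hij ⟨s, hs₀, hs⟩
      obtain ⟨l, hl⟩ := (hZ i).extendsAt (hI i) (i - 1) j (by lia) hij _ (hs (i - 1) (by lia))
      refine ⟨⟨Pi.single i l, fun k hk => Pi.single_eq_of_ne (by lia) _, fun k hk => ?_⟩,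
        fun k hk => ?_⟩
      · obtain rfl : k = i := by lia
        rw [Pi.single_eq_same, Preadditive.comp_sub, ← Category.assoc, hl, ← f.comm,
          ← Preadditive.sub_comp, sub_sub_cancel, Category.assoc, I.d_comp_d, comp_zero]
      · obtain rfl : k = i - 1 := by lia
        dsimp only
        rw [Pi.single_eq_same, hl, add_sub_cancel])
  exact nonempty_homotopy_zero (fun i j => (S i).1 j) (fun i j h => (S i).2.1 j h)
    fun i j k hij hjk => hS j k hjk i hij

end NullHomotopy

section Resolution

variable {R : Type u} [Ring R]

/-- The cochain complex with given terms and differentials. -/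
def complexOfFamily (P : ℤ → ModuleCat.{u} R) (δ : ∀ i j, i + 1 = j → (P i ⟶ P j))
    (hδ : ∀ i j k hij hjk, δ i j hij ≫ δ j k hjk = 0) : CochainComplex (ModuleCat.{u} R) ℤ where
  X := P
  d i j := if h : i + 1 = j then δ i j h else 0
  shape i j h := dif_neg h
  d_comp_d' i j k (hij : i + 1 = j) (hjk : j + 1 = k) := by
    rw [dif_pos hij, dif_pos hjk, hδ]

theorem complexOfFamily_d {P : ℤ → ModuleCat.{u} R} {δ : ∀ i j, i + 1 = j → (P i ⟶ P j)}
    {hδ : ∀ i j k hij hjk, δ i j hij ≫ δ j k hjk = 0} {i j : ℤ} (hij : i + 1 = j) :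
    (complexOfFamily P δ hδ).d i j = δ i j hij := dif_pos hij

/-- A term of a pure projective resolution, with its cycles and its augmentation. -/
structure ProjectiveStage (N : ModuleCat.{u} R) where
  obj : ModuleCat.{u} R
  isPureProjective : IsPureProjective obj
  cycles : Submodule R obj
  aug : obj →ₗ[R] N

/-- `s` is a term preceding `t` in a pure projective resolution, where `d` is the differential of
the resolved complex. -/
def ProjectiveStage.Precedes {N N' : ModuleCat.{u} R} (d : N →ₗ[R] N') (s : ProjectiveStage N)
    (t : ProjectiveStage N') : Prop :=
  ∃ δ : s.obj →ₗ[R] t.obj, (∀ x, δ x ∈ t.cycles) ∧ (∀ x, x ∈ s.cycles ↔ δ x = 0) ∧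
    (t.aug ∘ₗ δ = d ∘ₗ s.aug) ∧
    ∀ (Q : ModuleCat.{u} R), IsPureProjective Q → ∀ (x : Q →ₗ[R] t.obj) (y : Q →ₗ[R] N),
      (∀ q, x q ∈ t.cycles) → t.aug ∘ₗ x = d ∘ₗ y →
        ∃ w : Q →ₗ[R] s.obj, δ ∘ₗ w = x ∧ s.aug ∘ₗ w = y

theorem ProjectiveStage.exists_precedes {N N' : ModuleCat.{u} R} (d : N →ₗ[R] N')
    (t : ProjectiveStage N') : ∃ s : ProjectiveStage N, s.Precedes d t := by
  let Z : Submodule R (t.cycles × N) :=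
    LinearMap.ker ((t.aug ∘ₗ t.cycles.subtype).coprod (-d))
  have hZ (z : t.cycles × N) : z ∈ Z ↔ t.aug z.1 = d z.2 := by
    simp [Z, ← sub_eq_add_neg, sub_eq_zero]
  obtain ⟨P, g, hP, hg⟩ := exists_pureProjective_cover (R := R) Z
  let δ : P →ₗ[R] t.obj := t.cycles.subtype ∘ₗ LinearMap.fst R _ _ ∘ₗ Z.subtype ∘ₗ g
  refine ⟨⟨P, hP, LinearMap.ker δ, LinearMap.snd R _ _ ∘ₗ Z.subtype ∘ₗ g⟩, δ,
    fun x => (g x).1.1.2, fun x => Iff.rfl, LinearMap.ext fun x => (hZ _).1 (g x).2, ?_⟩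
  intro Q hQ x y hx hxy
  obtain ⟨w, hw⟩ := hQ.exists_lift hg (((x.codRestrict _ hx).prod y).codRestrict Z
    fun q => (hZ _).2 (LinearMap.congr_fun hxy q))
  refine ⟨w, LinearMap.ext fun q => ?_, LinearMap.ext fun q => ?_⟩
  · exact congrArg (fun z : Z => (z.1.1 : t.obj)) (LinearMap.congr_fun hw q)
  · exact congrArg (fun z : Z => z.1.2) (LinearMap.congr_fun hw q)

/-- The stage with zero term. -/
def ProjectiveStage.zero (N : ModuleCat.{u} R) : ProjectiveStage N where
  obj := ModuleCat.of R PUnit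
  isPureProjective := isPureProjective_of_subsingleton _
  cycles := ⊤
  aug := 0

theorem ProjectiveStage.zero_precedes_zero {N N' : ModuleCat.{u} R} [Subsingleton N]
    (d : N →ₗ[R] N') : (zero N).Precedes d (zero N') := by
  refine ⟨0, fun _ => trivial, fun _ => ⟨fun _ => rfl, fun _ => trivial⟩, ?_, ?_⟩
  · rw [LinearMap.comp_zero, Subsingleton.elim (zero N).aug 0, LinearMap.comp_zero]
  · intro Q _ x y _ _
    exact ⟨0, LinearMap.ext fun q => rfl, LinearMap.ext fun q => Subsingleton.elim _ _⟩

theorem exists_isPureQuasiIso_of_projectiveStages {X : CochainComplex (ModuleCat.{u} R) ℤ}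
    (S : ∀ i, ProjectiveStage (X.X i))
    (hS : ∀ i j, i + 1 = j → (S i).Precedes (X.d i j).hom (S j)) :
    ∃ (P : CochainComplex (ModuleCat.{u} R) ℤ) (π : P ⟶ X),
      IsPureQuasiIso π ∧ ∀ i, P.X i = (S i).obj := by
  choose δ δ_mem mem_cycles aug_δ exists_lift using hS
  let P : CochainComplex (ModuleCat.{u} R) ℤ := complexOfFamily (fun i => (S i).obj)
    (fun i j hij => ModuleCat.ofHom (δ i j hij)) fun i j k hij hjk => by
      ext x
      exact (mem_cycles j k hjk _).1 (δ_mem i j hij x)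
  have hd (i j hij) : (P.d i j).hom = δ i j hij :=
    congrArg ModuleCat.Hom.hom (complexOfFamily_d hij)
  let π : P ⟶ X :=
    { f := fun i => ModuleCat.ofHom (S i).aug
      comm' := fun i j hij => by
        ext x
        exact (LinearMap.congr_fun (aug_δ i j hij) x).symm.trans
          (congrArg (S j).aug (LinearMap.congr_fun (hd i j hij) x).symm) }
  refine ⟨P, π, (pureExact_iff_liftsAt _).2 fun Q hQ n => ?_, fun _ => rfl⟩
  refine liftsAt_mappingCone π Q (n - 1) n (n + 1) (n + 2) (by lia) rfl (by lia) ?_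
  intro x y hx hxy
  have neg_x_mem (q : Q) : (-x.hom) q ∈ (S (n + 1)).cycles :=
    neg_mem ((mem_cycles (n + 1) (n + 2) (by lia) _).2 (by
      rw [← hd]
      exact LinearMap.congr_fun (congrArg ModuleCat.Hom.hom hx) q))
  have aug_neg_x : (S (n + 1)).aug ∘ₗ (-x.hom) = (X.d n (n + 1)).hom ∘ₗ y.hom :=
    LinearMap.ext fun q => (map_neg (S (n + 1)).aug (x.hom q)).trans
      (neg_eq_of_add_eq_zero_right (LinearMap.congr_fun (congrArg ModuleCat.Hom.hom hxy) q))
  obtain ⟨w, δ_w, aug_w⟩ := exists_lift n (n + 1) rfl Q hQ (-x.hom) y.hom neg_x_mem aug_neg_x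
  refine ⟨ModuleCat.ofHom w, 0, ?_, ?_⟩
  · ext q
    exact (LinearMap.congr_fun (hd n (n + 1) rfl) (w q)).trans (LinearMap.congr_fun δ_w q)
  · rw [zero_comp, add_zero]
    exact ModuleCat.hom_ext aug_w

theorem exists_pureProjective_complex (X : CochainComplex (ModuleCat.{u} R) ℤ) (b : ℤ)
    (hX : ∀ i, b < i → IsZero (X.X i)) :
    ∃ (P : CochainComplex (ModuleCat.{u} R) ℤ) (π : P ⟶ X), IsPureQuasiIso π ∧
      (∀ i, IsPureProjective (P.X i)) ∧ ∀ i, b < i → IsZero (P.X i) := by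
  obtain ⟨S, hS₀, hS⟩ := exists_descendingFamily (T := fun i => ProjectiveStage (X.X i))
    (fun i j s t => s.Precedes (X.d i j).hom t) b (fun i _ => ProjectiveStage.zero _)
    (fun i j _ hi => by
      have := ModuleCat.subsingleton_of_isZero (hX i hi)
      exact ProjectiveStage.zero_precedes_zero _)
    fun i j _ t => t.exists_precedes _
  obtain ⟨P, π, hπ, hP⟩ := exists_isPureQuasiIso_of_projectiveStages S hS
  refine ⟨P, π, hπ, fun i => hP i ▸ (S i).isPureProjective, fun i hi => ?_⟩
  rw [hP, hS₀ i hi]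
  exact ModuleCat.isZero_of_subsingleton (ModuleCat.of R PUnit)

/-- A term of a pure injective resolution, with its boundaries and its coaugmentation. -/
structure InjectiveStage (N : ModuleCat.{u} R) where
  obj : ModuleCat.{u} R
  isPureInjective : IsPureInjective obj
  boundaries : Submodule R obj
  coaug : N →ₗ[R] obj

/-- `s` is a term preceding `t` in a pure injective resolution, where `d` is the differential of
the resolved complex. -/
def InjectiveStage.Precedes {N N' : ModuleCat.{u} R} (d : N →ₗ[R] N') (s : InjectiveStage N)
    (t : InjectiveStage N') : Prop :=
  ∃ δ : s.obj →ₗ[R] t.obj, (∀ x ∈ s.boundaries, δ x = 0) ∧ LinearMap.range δ = t.boundaries ∧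
    (δ ∘ₗ s.coaug = t.coaug ∘ₗ d) ∧
    ∀ (E : ModuleCat.{u} R), IsPureInjective E → ∀ (x : N' →ₗ[R] E) (y : s.obj →ₗ[R] E),
      (∀ z ∈ s.boundaries, y z = 0) → y ∘ₗ s.coaug = x ∘ₗ d →
        ∃ w : t.obj →ₗ[R] E, w ∘ₗ δ = y ∧ w ∘ₗ t.coaug = x

theorem InjectiveStage.exists_precedes {N N' : ModuleCat.{u} R} (d : N →ₗ[R] N')
    (s : InjectiveStage N) : ∃ t : InjectiveStage N', s.Precedes d t := by
  let U : Submodule R (s.obj × N') := s.boundaries.map (LinearMap.inl R _ _) ⊔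
    LinearMap.range (s.coaug.prod (-d))
  obtain ⟨E, g, hE, hg⟩ := exists_pureInjective_embedding (R := R) ((s.obj × N') ⧸ U)
  let δ : s.obj →ₗ[R] E := g ∘ₗ U.mkQ ∘ₗ LinearMap.inl R _ _
  refine ⟨⟨E, hE, LinearMap.range δ, g ∘ₗ U.mkQ ∘ₗ LinearMap.inr R _ _⟩, δ, fun x hx => ?_, rfl,
    LinearMap.ext fun z => ?_, fun E' hE' x y hy hxy => ?_⟩
  · refine (congrArg g ?_).trans (map_zero g)
    exact (Submodule.Quotient.mk_eq_zero _).2 (Submodule.mem_sup_left ⟨x, hx, rfl⟩)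
  · refine congrArg g ((Submodule.Quotient.eq _).2 (Submodule.mem_sup_right ⟨z, ?_⟩))
    simp
  · obtain ⟨w, hw⟩ := hE'.exists_extension hg (U.liftQ (y.coprod x) (by
      refine sup_le ?_ ?_
      · rintro _ ⟨z, hz, rfl⟩
        simpa using hy z hz
      · rintro _ ⟨z, rfl⟩
        simpa [← sub_eq_add_neg, sub_eq_zero] using LinearMap.congr_fun hxy z))
    refine ⟨w, LinearMap.ext fun z => ?_, LinearMap.ext fun z => ?_⟩
    · refine (LinearMap.congr_fun hw (U.mkQ (z, 0))).trans ?_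
      simp
    · refine (LinearMap.congr_fun hw (U.mkQ (0, z))).trans ?_
      simp

/-- The stage with zero term. -/
def InjectiveStage.zero (N : ModuleCat.{u} R) : InjectiveStage N where
  obj := ModuleCat.of R PUnit
  isPureInjective := isPureInjective_of_subsingleton _
  boundaries := ⊥
  coaug := 0

theorem InjectiveStage.zero_precedes_zero {N N' : ModuleCat.{u} R} [Subsingleton N']
    (d : N →ₗ[R] N') : (zero N).Precedes d (zero N') := by
  refine ⟨0, fun _ _ => rfl, LinearMap.range_zero, LinearMap.ext fun _ => rfl, ?_⟩
  intro E _ x y _ _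
  refine ⟨0, LinearMap.ext fun _ => (map_zero y).symm, LinearMap.ext fun q => ?_⟩
  rw [Subsingleton.elim q 0, map_zero, map_zero]

theorem exists_isPureQuasiIso_of_injectiveStages {X : CochainComplex (ModuleCat.{u} R) ℤ}
    (S : ∀ i, InjectiveStage (X.X i))
    (hS : ∀ i j, i + 1 = j → (S i).Precedes (X.d i j).hom (S j)) :
    ∃ (I : CochainComplex (ModuleCat.{u} R) ℤ) (ι : X ⟶ I),
      IsPureQuasiIso ι ∧ ∀ i, I.X i = (S i).obj := by
  choose δ δ_boundary range_δ δ_coaug exists_extension using hS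
  let I : CochainComplex (ModuleCat.{u} R) ℤ := complexOfFamily (fun i => (S i).obj)
    (fun i j hij => ModuleCat.ofHom (δ i j hij)) fun i j k hij hjk => by
      ext x
      exact δ_boundary j k hjk _ (range_δ i j hij ▸ LinearMap.mem_range_self _ x)
  have hd (i j hij) : (I.d i j).hom = δ i j hij :=
    congrArg ModuleCat.Hom.hom (complexOfFamily_d hij)
  let ι : X ⟶ I :=
    { f := fun i => ModuleCat.ofHom (S i).coaug
      comm' := fun i j hij => by
        ext x
        exact (LinearMap.congr_fun (hd i j hij) _).trans
          (LinearMap.congr_fun (δ_coaug i j hij) x) }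
  refine ⟨I, ι, (pureExact_iff_extendsAt _).2 fun E hE n => ?_, fun _ => rfl⟩
  refine extendsAt_mappingCone ι E (n - 1) n (n + 1) (n + 2) (by lia) rfl (by lia) ?_
  intro x y hy hxy
  have y_boundary : ∀ z ∈ (S n).boundaries, y.hom z = 0 := by
    rw [← range_δ (n - 1) n (by lia), ← hd]
    rintro _ ⟨z, rfl⟩
    exact LinearMap.congr_fun (congrArg ModuleCat.Hom.hom hy) z
  obtain ⟨w, w_δ, w_coaug⟩ := exists_extension n (n + 1) rfl E hE x.hom y.hom y_boundary
    (congrArg ModuleCat.Hom.hom hxy)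
  refine ⟨0, ModuleCat.ofHom w, ?_, ?_⟩
  · ext z
    exact (congrArg w (LinearMap.congr_fun (hd n (n + 1) rfl) z)).trans
      (LinearMap.congr_fun w_δ z)
  · rw [comp_zero, sub_zero]
    exact ModuleCat.hom_ext w_coaug

theorem exists_pureInjective_complex (X : CochainComplex (ModuleCat.{u} R) ℤ) (b : ℤ)
    (hX : ∀ i, i < b → IsZero (X.X i)) :
    ∃ (I : CochainComplex (ModuleCat.{u} R) ℤ) (ι : X ⟶ I), IsPureQuasiIso ι ∧
      (∀ i, IsPureInjective (I.X i)) ∧ ∀ i, i < b → IsZero (I.X i) := by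
  obtain ⟨S, hS₀, hS⟩ := exists_ascendingFamily (T := fun i => InjectiveStage (X.X i))
    (fun i j s t => s.Precedes (X.d i j).hom t) b (fun i _ => InjectiveStage.zero _)
    (fun i j _ hj => by
      have := ModuleCat.subsingleton_of_isZero (hX j hj)
      exact InjectiveStage.zero_precedes_zero _)
    fun i j _ t => t.exists_precedes _
  obtain ⟨I, ι, hι, hI⟩ := exists_isPureQuasiIso_of_injectiveStages S hS
  refine ⟨I, ι, hι, fun i => hI i ▸ (S i).isPureInjective, fun i hi => ?_⟩
  rw [hI, hS₀ i hi]
  exact ModuleCat.isZero_of_subsingleton (ModuleCat.of R PUnit)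

end Resolution

section Solutions

variable {R : Type v} [Ring R] {ι κ : Type} [Fintype κ] (r : ι → κ → ℤ)

/-- The solutions in `M` of a finite homogeneous system of linear equations with integer
coefficients. The functor `solutions r` turns a family of cochains satisfying such a system into
a single cochain, which reduces purity over `ℤ` of a Hom complex to its acyclicity. -/
def solutions (M : Type u) [AddCommGroup M] [Module R M] : Submodule R (κ → M) where
  carrier := {c | ∀ i, ∑ j, r i j • c j = 0}
  zero_mem' := by simp
  add_mem' := fun {x y} hx hy i => by
    simp only [Pi.add_apply, smul_add, Finset.sum_add_distrib, hx i, hy i, add_zero]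
  smul_mem' := fun a x hx i => by
    simp only [Pi.smul_apply, smul_comm _ a, ← Finset.smul_sum, hx i, smul_zero]

variable {A B C : Type u} [AddCommGroup A] [Module R A] [AddCommGroup B] [Module R B]
  [AddCommGroup C] [Module R C]

/-- The action of a linear map on solutions. -/
def solutions.map (f : A →ₗ[R] B) : solutions (R := R) r A →ₗ[R] solutions (R := R) r B :=
  (f.compLeft κ).restrict fun c hc i => by simpa using congrArg f (hc i)

theorem solutions.isClosed [TopologicalSpace A] [T1Space A] [ContinuousAdd A]
    [ContinuousConstSMul R A] : IsClosed (solutions (R := R) r A : Set (κ → A)) := by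
  have : (solutions (R := R) r A : Set (κ → A)) =
      ⋂ i, (fun c => ∑ j, (r i j : R) • c j) ⁻¹' {0} := by
    ext c
    simp [solutions, Int.cast_smul_eq_zsmul]
  rw [this]
  exact isClosed_iInter fun i => isClosed_singleton.preimage (by fun_prop)

theorem isPureInjective_solutions {N : ModuleCat.{u} R} (hN : IsPureInjective N) :
    IsPureInjective (ModuleCat.of R (solutions (R := R) r N)) := by
  let E := Character (Character N)
  have : ContinuousAdd (solutions (R := R) r E) :=
    inferInstanceAs (ContinuousAdd (solutions (R := R) r E).toAddSubmonoid)
  have : ContinuousConstSMul R (solutions (R := R) r E) :=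
    ⟨fun a => ((continuous_const_smul a).comp continuous_subtype_val).subtype_mk _⟩
  have : CompactSpace (solutions (R := R) r E) :=
    isCompact_iff_compactSpace.1 (solutions.isClosed r).isCompact
  obtain ⟨p, hp⟩ := hN.exists_retraction_charEval
  refine (isPureInjective_of_compactSpace (R := R) (solutions (R := R) r E)).of_retract
    (i := solutions.map r (charEval R N)) (p := solutions.map r p) ?_
  exact LinearMap.ext fun c => Subtype.ext (funext fun j => LinearMap.congr_fun hp (c.1 j))

/-- A family of solutions of one system which solves a second one is the same as a solution of the
combination of the two systems with coefficients in `R`. -/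
theorem ExactOnSystems.solutions [Finite ι] {d : A →ₗ[R] B} {e : B →ₗ[R] C}
    (h : ExactOnSystems d e) :
    ExactOnSystems (solutions.map r d) (solutions.map r e) := by
  classical
  cases nonempty_fintype ι
  intro ι' κ' _ _ s c hc hs
  let combined : (ι' × κ) ⊕ (κ' × ι) → κ' × κ → R := Sum.elim
    (fun p q => if q.2 = p.2 then s p.1 q.1 else 0)
    (fun p q => if q.1 = p.1 then (r p.2 q.2 : R) else 0)
  have combined_inl {M : Type u} [AddCommGroup M] [Module R M] (x : κ' × κ → M) (a j) :
      ∑ q, combined (.inl (a, j)) q • x q = ∑ b, s a b • x (b, j) := by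
    simp [combined, Fintype.sum_prod_type, ite_smul]
  have combined_inr {M : Type u} [AddCommGroup M] [Module R M] (x : κ' × κ → M) (b i) :
      ∑ q, combined (.inr (b, i)) q • x q = ∑ j, r i j • x (b, j) := by
    rw [Fintype.sum_prod_type, Finset.sum_eq_single b (by simp +contextual [combined]) (by simp)]
    simp [combined, Int.cast_smul_eq_zsmul]
  obtain ⟨x, hx, hx'⟩ := h _ _ combined (fun q => (c q.1).1 q.2)
    (fun q => congrFun (congrArg Subtype.val (hc q.1)) q.2) (by
      rintro (⟨a, j⟩ | ⟨b, i⟩)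
      · rw [combined_inl]
        simpa using congrFun (congrArg Subtype.val (hs a)) j
      · rw [combined_inr]
        exact (c b).2 i)
  refine ⟨fun b => ⟨fun j => x (b, j), fun i => (combined_inr x b i).symm.trans (hx' _)⟩,
    fun b => Subtype.ext (funext fun j => hx (b, j)), fun a => Subtype.ext (funext fun j => ?_)⟩
  simpa using (combined_inl x a j).symm.trans (hx' _)

end Solutions

section SolutionsComplex

variable {R : Type u} [Ring R] {ι κ : Type} [Fintype κ] (r : ι → κ → ℤ)
  (Y : CochainComplex (ModuleCat.{u} R) ℤ)

/-- The complex of solutions of a finite homogeneous system with integer coefficients. -/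
def solutionsComplex : CochainComplex (ModuleCat.{u} R) ℤ where
  X n := ModuleCat.of R (solutions (R := R) r (Y.X n))
  d n m := ModuleCat.ofHom (solutions.map r (Y.d n m).hom)
  shape n m h := by
    ext x q
    change (Y.d n m).hom (x.1 q) = 0
    rw [Y.shape n m h]
    rfl
  d_comp_d' i j k _ _ := by
    ext x q
    exact d_hom_apply_d_hom_apply Y i j k (x.1 q)

/-- The components of a solution. -/
def solutionsComplex.proj (j : κ) : solutionsComplex r Y ⟶ Y where
  f n := ModuleCat.ofHom (LinearMap.proj j ∘ₗ (solutions (R := R) r (Y.X n)).subtype)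
  comm' _ _ _ := rfl

variable {Y}

theorem PureExact.solutionsComplex [Finite ι] (hY : PureExact Y) :
    PureExact (solutionsComplex r Y) :=
  pureExact_iff_exactOnSystems.2 fun i j k hi hk =>
    (pureExact_iff_exactOnSystems.1 hY i j k hi hk).solutions r

theorem isKPureInjective_solutionsComplex {b : ℤ} (hb : ∀ i, i < b → IsZero (Y.X i))
    (hY : ∀ i, IsPureInjective (Y.X i)) : IsKPureInjective (solutionsComplex r Y) := by
  refine isKPureInjective_of_bounded (b := b) (fun i hi => ?_)
    fun i => isPureInjective_solutions r (hY i)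
  have := ModuleCat.subsingleton_of_isZero (hb i hi)
  have : Subsingleton (solutions (R := R) r (Y.X i)) := inferInstance
  exact ModuleCat.isZero_of_subsingleton (ModuleCat.of R (solutions (R := R) r (Y.X i)))

end SolutionsComplex

section SolutionsCochain

open CochainComplex CochainComplex.HomComplex

variable {R : Type u} [Ring R] {X Y : CochainComplex (ModuleCat.{u} R) ℤ} {ι κ : Type}
  [Fintype κ] {r : ι → κ → ℤ} {n : ℤ}

/-- The value of a component of a cochain, as a homomorphism in the cochain. -/
def cochainEval (p q : ℤ) (hpq : p + n = q) (x : X.X p) : Cochain X Y n →+ Y.X q where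
  toFun z := (z.v p q hpq).hom x
  map_zero' := rfl
  map_add' _ _ := rfl

theorem cochainEval_sum_zsmul (c : κ → Cochain X Y n) (m : κ → ℤ) (p q : ℤ)
    (hpq : p + n = q) (x : X.X p) : ((∑ j, m j • c j : Cochain X Y n).v p q hpq).hom x =
      ∑ j, m j • ((c j).v p q hpq).hom x := by
  let eval : Cochain X Y n →+ Y.X q := cochainEval p q hpq x
  exact (map_sum eval _ _).trans (Finset.sum_congr rfl fun j _ => map_zsmul eval _ _)

/-- The cochain with components `c j`. -/
def solutionsCochain (c : κ → Cochain X Y n) (hc : ∀ i, ∑ j, r i j • c j = 0) :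
    Cochain X (solutionsComplex r Y) n :=
  Cochain.mk fun p q hpq =>
    ModuleCat.ofHom ((LinearMap.pi fun j => ((c j).v p q hpq).hom).codRestrict
      (solutions (R := R) r (Y.X q)) fun x i =>
        (cochainEval_sum_zsmul c (r i) p q hpq x).symm.trans (by rw [hc]; rfl))

theorem solutionsCochain_comp_proj (c : κ → Cochain X Y n) (hc : ∀ i, ∑ j, r i j • c j = 0)
    (j : κ) : (solutionsCochain c hc).comp (Cochain.ofHom (solutionsComplex.proj r Y j))
      (add_zero n) = c j := by
  ext p q hpq x
  simp only [solutionsCochain, Cochain.comp_zero_cochain_v, Cochain.ofHom_v, ModuleCat.hom_comp,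
    LinearMap.coe_comp, Function.comp_apply]
  rfl

theorem comp_proj_v_hom (z : Cochain X (solutionsComplex r Y) n) (j : κ) (p q : ℤ)
    (hpq : p + n = q) (x : X.X p) :
    ((z.comp (Cochain.ofHom (solutionsComplex.proj r Y j)) (add_zero n)).v p q hpq).hom x =
      ((z.v p q hpq).hom x : solutions (R := R) r (Y.X q)).1 j := by
  rw [Cochain.comp_zero_cochain_v, Cochain.ofHom_v]
  rfl

theorem solutionsCochain_eq_zero {z : Cochain X (solutionsComplex r Y) n}
    (hz : ∀ j, z.comp (Cochain.ofHom (solutionsComplex.proj r Y j)) (add_zero n) = 0) :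
    z = 0 := by
  ext p q hpq x
  refine Subtype.ext (funext fun j => ?_)
  rw [← comp_proj_v_hom, hz]
  rfl

theorem sum_zsmul_comp_proj (z : Cochain X (solutionsComplex r Y) n) (i : ι) :
    ∑ j, r i j • z.comp (Cochain.ofHom (solutionsComplex.proj r Y j)) (add_zero n) = 0 := by
  ext p q hpq x
  rw [cochainEval_sum_zsmul]
  simp_rw [comp_proj_v_hom]
  exact ((z.v p q hpq).hom x : solutions (R := R) r (Y.X q)).2 i

end SolutionsCochain

section Preserves

open CochainComplex CochainComplex.HomComplex

variable {R : Type u} [Ring R] {X Y : CochainComplex (ModuleCat.{u} R) ℤ}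

theorem exactOnSystems_homComplex (i n k : ℤ) (hi : i + 1 = n) (hk : n + 1 = k)
    (h : ∀ (ι κ : Type) [Fintype ι] [Fintype κ] (r : ι → κ → ℤ),
      HomVanishes X (solutionsComplex r Y) n) :
    ExactOnSystems ((HomComplex X Y).d i n).hom.toIntLinearMap
      ((HomComplex X Y).d n k).hom.toIntLinearMap := by
  intro ι κ _ _ r (c : κ → Cochain X Y n) (hc : ∀ j, δ n k (c j) = 0)
    (hr : ∀ i, ∑ j, r i j • c j = 0)
  have δ_solutionsCochain : δ n k (solutionsCochain c hr) = 0 :=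
    solutionsCochain_eq_zero fun j => by rw [← δ_comp_ofHom, solutionsCochain_comp_proj, hc]
  obtain ⟨β, hβ⟩ := (mem_coboundaries_iff _ i hi).1
    (h ι κ r (Cocycle.mk (solutionsCochain c hr) k hk δ_solutionsCochain))
  refine ⟨fun j => β.comp (Cochain.ofHom (solutionsComplex.proj r Y j)) (add_zero i),
    fun j => ?_, sum_zsmul_comp_proj β⟩
  refine (δ_comp_ofHom β (solutionsComplex.proj r Y j) n).trans ?_
  rw [hβ]
  exact solutionsCochain_comp_proj c hr j

theorem pureExactAb_homComplex
    (h : ∀ (ι κ : Type) [Fintype ι] [Fintype κ] (r : ι → κ → ℤ) (n : ℤ),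
      HomVanishes X (solutionsComplex r Y) n) : PureExactAb (HomComplex X Y) := by
  intro n
  have hd (i j k : ℤ) (x : (HomComplex X Y).X i) : ((HomComplex X Y).d j k).hom.toIntLinearMap
      (((HomComplex X Y).d i j).hom.toIntLinearMap x) = 0 := δ_δ i j k x
  exact isPureExactPair_of_exactOnSystems (hd _ _ _) (hd _ _ (n + 1 + 1)) (hd _ _ (n + 1 + 1 + 1))
    (exactOnSystems_homComplex _ _ _ (by lia) rfl fun ι κ _ _ r => h ι κ r _)
    (exactOnSystems_homComplex _ _ _ rfl rfl fun ι κ _ _ r => h ι κ r _)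
    (exactOnSystems_homComplex _ _ _ rfl rfl fun ι κ _ _ r => h ι κ r _)

theorem IsKPureProjective.pureExactAb (hX : IsKPureProjective X) (hY : PureExact Y) :
    PureExactAb (HomComplex X Y) :=
  pureExactAb_homComplex fun _ _ _ _ r n => hX.homVanishes (hY.solutionsComplex r) n

theorem pureExactAb_homComplex_of_isPureInjective {b : ℤ} (hX : PureExact X)
    (hb : ∀ i, i < b → IsZero (Y.X i)) (hY : ∀ i, IsPureInjective (Y.X i)) :
    PureExactAb (HomComplex X Y) :=
  pureExactAb_homComplex fun _ _ _ _ r n =>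
    (isKPureInjective_solutionsComplex r hb hY).homVanishes hX n

theorem homVanishes_of_pureExactAb {n : ℤ} (h : PureExactAb (HomComplex X Y)) :
    HomVanishes X Y n := by
  intro z
  obtain ⟨β, hβ⟩ := ((h n).exact (z : Cochain X Y n)).1 (z.δ_eq_zero (n + 1))
  exact (mem_coboundaries_iff _ (n - 1) (by lia)).2 ⟨β, hβ⟩

theorem PureProjectiveResolution.isKPureProjective (P : PureProjectiveResolution X) :
    IsKPureProjective P.complex :=
  isKPureProjective_of_homVanishes fun Z hZ => homVanishes_of_pureExactAb (P.preserves Z hZ)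

theorem PureInjectiveResolution.isKPureInjective (I : PureInjectiveResolution X) :
    IsKPureInjective I.complex :=
  isKPureInjective_of_homVanishes fun Z hZ => homVanishes_of_pureExactAb (I.preserves Z hZ)

end Preserves

section Dimensions

open CochainComplex CochainComplex.HomComplex

variable {R : Type u} [Ring R] {X Y : CochainComplex (ModuleCat.{u} R) ℤ} {n s : ℤ}

/-- The terms of `X` vanish in all large degrees. -/
def IsBoundedAbove (X : CochainComplex (ModuleCat.{u} R) ℤ) : Prop :=
  ∃ b : ℤ, ∀ i, b < i → IsZero (X.X i)

/-- The terms of `X` vanish in all small degrees. -/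
def IsBoundedBelow (X : CochainComplex (ModuleCat.{u} R) ℤ) : Prop :=
  ∃ a : ℤ, ∀ i, i < a → IsZero (X.X i)

theorem IsBounded.isBoundedAbove (hX : IsBounded X) : IsBoundedAbove X :=
  let ⟨_, b, h⟩ := hX
  ⟨b, fun i hi => h i (.inr hi)⟩

theorem IsBounded.isBoundedBelow (hX : IsBounded X) : IsBoundedBelow X :=
  let ⟨a, _, h⟩ := hX
  ⟨a, fun i hi => h i (.inl hi)⟩

theorem isZero_single₀ (M : ModuleCat.{u} R) {i : ℤ} (hi : i ≠ 0) : IsZero ((single₀ M).X i) :=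
  HomologicalComplex.isZero_single_obj_X _ _ _ _ hi

theorem isBounded_single₀ (M : ModuleCat.{u} R) : IsBounded (single₀ M) :=
  ⟨0, 0, fun _ hi => isZero_single₀ M (by lia)⟩

theorem pureExactAt_of_isZero (h : IsZero (X.X n)) : PureExactAt X n := by
  have := ModuleCat.subsingleton_of_isZero h
  refine isPureExactPair_of_exactOnSystems
    (d₂ := (LinearMap.id : X.X (n + 1) →ₗ[R] X.X (n + 1)))
    (d₃ := (0 : X.X (n + 1) →ₗ[R] X.X (n + 1)))
    (d_hom_apply_d_hom_apply X _ _ _) (fun x => ?_) (fun _ => rfl) ?_ ?_ ?_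
  · rw [Subsingleton.elim x 0, map_zero, map_zero]
  · exact fun ι κ _ _ r c _ _ => ⟨0, fun j => Subsingleton.elim _ _, fun i => by simp⟩
  · exact fun ι κ _ _ r c hc _ => ⟨0, fun j => (map_zero _).trans (hc j).symm, fun i => by simp⟩
  · exact fun ι κ _ _ r c _ hr => ⟨c, fun j => rfl, hr⟩

theorem homVanishes_of_isZero (h : ∀ p q, p + n = q → IsZero (X.X p) ∨ IsZero (Y.X q)) :
    HomVanishes X Y n := by
  intro z
  have z_eq_zero : z = 0 := Subtype.ext <| Cochain.ext _ _ fun p q hpq =>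
    (h p q hpq).elim (fun hp => hp.eq_of_src _ _) fun hq => hq.eq_of_tgt _ _
  exact z_eq_zero ▸ zero_mem _

theorem isZero_truncLE_of_isZero {i : ℤ} (h : IsZero (X.X i)) : IsZero ((truncLE X s).X i) := by
  have := ModuleCat.subsingleton_of_isZero h
  have : Subsingleton (truncLESubmodule X s i) := inferInstance
  exact ModuleCat.isZero_of_subsingleton (ModuleCat.of R (truncLESubmodule X s i))

theorem isZero_truncGE_of_isZero {i : ℤ} (h : IsZero (X.X i)) : IsZero ((truncGE X s).X i) := by
  have := ModuleCat.subsingleton_of_isZero h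
  have : Subsingleton (X.X i ⧸ truncGESubmodule X s i) :=
    (Submodule.mkQ_surjective _).subsingleton
  exact ModuleCat.isZero_of_subsingleton (ModuleCat.of R (X.X i ⧸ truncGESubmodule X s i))

theorem hasPidLE_of_liftsAt (hY : IsBoundedBelow Y)
    (h : ∀ {I : CochainComplex (ModuleCat.{u} R) ℤ} {ι : Y ⟶ I}, IsPureQuasiIso ι →
      IsKPureInjective I → ∀ (M : ModuleCat.{u} R) (k : ℤ), n < k → LiftsAt M I k) :
    HasPidLE Y n := by
  obtain ⟨a, ha⟩ := hY
  obtain ⟨I, ι, hι, hI, hIa⟩ := exists_pureInjective_complex Y a ha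
  have hK := isKPureInjective_of_bounded hIa hI
  have liftsAt := h hι hK
  have hT (i : ℤ) : IsPureInjective ((truncLE I n).X i) :=
    isPureInjective_truncLE hI (fun M => liftsAt M (n + 1) (by lia)) i
  have hTa (i : ℤ) (hi : i < a) : IsZero ((truncLE I n).X i) := isZero_truncLE_of_isZero (hIa i hi)
  obtain ⟨ι', hι'⟩ := hK.exists_pureQuasiIso (isKPureInjective_of_bounded hTa hT) hι
    (isPureQuasiIso_truncLE fun M _ => liftsAt M)
  exact ⟨⟨_, ι', hι', hT, fun Z hZ => pureExactAb_homComplex_of_isPureInjective hZ hTa hT⟩,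
    fun i hi => isZero_truncLE hi⟩

theorem hasPidLE_of_forall_single₀ (h : ∀ M : ModuleCat.{u} R, HasPpdLE (single₀ M) n)
    (hY : IsBoundedBelow Y) (hs : ∀ k, s < k → PureExactAt Y k) : HasPidLE Y (n + s) := by
  refine hasPidLE_of_liftsAt hY fun hι hK M k hk => ?_
  obtain ⟨P, hP⟩ := h M
  rw [← homVanishes_single_left, ← hK.homVanishes_iff P.isPureQuasiIso,
    ← P.isKPureProjective.homVanishes_iff hι,
    ← P.isKPureProjective.homVanishes_iff (isPureQuasiIso_truncLE (s := s)
      fun Q hQ j hj => (hs j hj).liftsAt hQ)]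
  refine homVanishes_of_isZero fun p q hpq => ?_
  by_cases hp : p < -n
  · exact .inl (hP p hp)
  · exact .inr (isZero_truncLE (by lia))

theorem HasPidLE.homVanishes {m c i : ℤ} (hY : HasPidLE Y m) (hc : ∀ k, k < c → PureExactAt X k)
    (P : PureProjectiveResolution X) (hi : m - c < i) : HomVanishes P.complex Y i := by
  obtain ⟨I, hI⟩ := hY
  rw [P.isKPureProjective.homVanishes_iff I.isPureQuasiIso,
    I.isKPureInjective.homVanishes_iff P.isPureQuasiIso,
    I.isKPureInjective.homVanishes_iff (isPureQuasiIso_truncGE (s := c)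
      fun E hE j hj => (hc j hj).extendsAt hE)]
  refine homVanishes_of_isZero fun p q hpq => ?_
  by_cases hp : p < c
  · exact .inl (isZero_truncGE hp)
  · exact .inr (hI q (by lia))

theorem hasPpdLE_of_homVanishes (hX : IsBoundedAbove X)
    (h : ∀ (P : PureProjectiveResolution X) (N : ModuleCat.{u} R) (k : ℤ), n < k →
      HomVanishes P.complex (single₀ N) k) : HasPpdLE X n := by
  obtain ⟨b, hb⟩ := hX
  obtain ⟨P, π, hπ, hP, hPb⟩ := exists_pureProjective_complex X b hb
  have hK := isKPureProjective_of_bounded hPb hP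
  have extendsAt (N : ModuleCat.{u} R) (j : ℤ) (hj : j < -n) : ExtendsAt N P j :=
    (homVanishes_single_right N (add_neg_cancel j)).1
      (h ⟨P, π, hπ, hP, fun _ hZ => hK.pureExactAb hZ⟩ N (-j) (by lia))
  have hT := isPureProjective_truncGE hP fun N => extendsAt N (-n - 1) (by lia)
  have hKT := isKPureProjective_of_bounded (fun i hi => isZero_truncGE_of_isZero (hPb i hi)) hT
  obtain ⟨π', hπ'⟩ := hK.exists_pureQuasiIso hKT hπ
    (isPureQuasiIso_truncGE fun N _ => extendsAt N)
  exact ⟨⟨_, π', hπ', hT, fun Z hZ => hKT.pureExactAb hZ⟩, fun i hi => isZero_truncGE hi⟩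

theorem PureProjectiveResolution.homVanishes_of_pureExact (P : PureProjectiveResolution X)
    (hX : PureExact X) (Y : CochainComplex (ModuleCat.{u} R) ℤ) (i : ℤ) :
    HomVanishes P.complex Y i := by
  have homVanishes_self := (P.isKPureProjective.homVanishes_iff P.isPureQuasiIso 0).2
    (P.isKPureProjective.homVanishes hX 0)
  let e := (shiftFunctorZero _ ℤ).app ((toHtpy R).obj P.complex)
  have id_eq_zero : 𝟙 ((toHtpy R).obj P.complex) = 0 := by
    rw [← cancel_mono e.inv, zero_comp]
    exact homVanishes_iff_hom.1 homVanishes_self _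
  exact homVanishes_iff_hom.2 fun f => by rw [← Category.id_comp f, id_eq_zero, zero_comp]

end Dimensions

section ExtendedIntegers

variable {R : Type u} [Ring R] {X Y : CochainComplex (ModuleCat.{u} R) ℤ} {n : ℤ}

theorem HasPpdLE.mono {m : ℤ} (h : HasPpdLE X m) (hmn : m ≤ n) : HasPpdLE X n :=
  h.imp fun _ hP i hi => hP i (by lia)

theorem HasPidLE.mono {m : ℤ} (h : HasPidLE X m) (hmn : m ≤ n) : HasPidLE X n :=
  h.imp fun _ hI i hi => hI i (by lia)

theorem iInf_int_le_iff {F : ℤ → Prop} (hF : ∀ k m, F k → k ≤ m → F m) :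
    ⨅ (k : ℤ) (_ : F k), ((k : ℝ) : EReal) ≤ ((n : ℝ) : EReal) ↔ F n := by
  refine ⟨fun h => ?_, fun h => iInf₂_le n h⟩
  by_contra hn
  have succ_le : (((n + 1 : ℤ) : ℝ) : EReal) ≤ ⨅ (k : ℤ) (_ : F k), ((k : ℝ) : EReal) := by
    refine le_iInf₂ fun k hk => ?_
    have : n < k := lt_of_not_ge fun hkn => hn (hF k n hk hkn)
    exact_mod_cast Int.add_one_le_iff.2 this
  have : n + 1 ≤ n := by exact_mod_cast succ_le.trans h
  lia

theorem ppd_le_iff : ppd X ≤ ((n : ℝ) : EReal) ↔ HasPpdLE X n :=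
  iInf_int_le_iff fun _ _ => HasPpdLE.mono

theorem pid_le_iff : pid X ≤ ((n : ℝ) : EReal) ↔ HasPidLE X n :=
  iInf_int_le_iff fun _ _ => HasPidLE.mono

theorem pureGlobalDim_le_iff : pureGlobalDim R ≤ ((n : ℝ) : EReal) ↔
    ∀ M : ModuleCat.{u} R, HasPpdLE (single₀ M) n :=
  iSup_le_iff.trans (forall_congr' fun _ => ppd_le_iff)

theorem le_infP_iff {x : EReal} :
    x ≤ infP X ↔ ∀ k : ℤ, ((k : ℝ) : EReal) < x → PureExactAt X k := by
  rw [infP, le_iInf₂_iff]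
  exact forall_congr' fun k => by rw [not_imp_comm, not_le]

theorem supP_le_iff {x : EReal} :
    supP X ≤ x ↔ ∀ k : ℤ, x < ((k : ℝ) : EReal) → PureExactAt X k := by
  rw [supP, iSup₂_le_iff]
  exact forall_congr' fun k => by rw [not_imp_comm, not_le]

theorem int_le_infP_iff {c : ℤ} :
    ((c : ℝ) : EReal) ≤ infP X ↔ ∀ k, k < c → PureExactAt X k := by
  simp only [le_infP_iff, EReal.coe_lt_coe_iff, Int.cast_lt]

theorem supP_le_int_iff {s : ℤ} :
    supP X ≤ ((s : ℝ) : EReal) ↔ ∀ k, s < k → PureExactAt X k := by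
  simp only [supP_le_iff, EReal.coe_lt_coe_iff, Int.cast_lt]

theorem infP_eq_top_iff : infP X = ⊤ ↔ PureExact X := by
  rw [eq_top_iff, le_infP_iff]
  exact forall_congr' fun k => forall_prop_of_true (EReal.coe_lt_top _)

theorem supP_eq_bot_iff : supP X = ⊥ ↔ PureExact X := by
  rw [eq_bot_iff, supP_le_iff]
  exact forall_congr' fun k => forall_prop_of_true (EReal.bot_lt_coe _)

theorem infP_eq_bot_or_top_or_int (X : CochainComplex (ModuleCat.{u} R) ℤ) :
    infP X = ⊥ ∨ infP X = ⊤ ∨ ∃ c : ℤ, infP X = ((c : ℝ) : EReal) := by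
  induction h : infP X with
  | bot => exact .inl rfl
  | top => exact .inr (.inl rfl)
  | coe r =>
    refine .inr (.inr ⟨⌈r⌉, (EReal.coe_le_coe_iff.2 (Int.le_ceil r)).antisymm ?_⟩)
    rw [← h, int_le_infP_iff]
    exact fun k hk => le_infP_iff.1 h.ge k (EReal.coe_lt_coe_iff.2 (Int.lt_ceil.1 hk))

theorem supP_eq_bot_or_top_or_int (X : CochainComplex (ModuleCat.{u} R) ℤ) :
    supP X = ⊥ ∨ supP X = ⊤ ∨ ∃ s : ℤ, supP X = ((s : ℝ) : EReal) := by
  induction h : supP X with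
  | bot => exact .inl rfl
  | top => exact .inr (.inl rfl)
  | coe r =>
    refine .inr (.inr ⟨⌊r⌋, le_antisymm ?_ (EReal.coe_le_coe_iff.2 (Int.floor_le r))⟩)
    rw [← h, supP_le_int_iff]
    exact fun k hk => supP_le_iff.1 h.le k (EReal.coe_lt_coe_iff.2 (Int.floor_lt.1 hk))

theorem eq_bot_of_forall_le_int {y : EReal} (h : ∀ m : ℤ, y ≤ ((m : ℝ) : EReal)) : y = ⊥ := by
  refine EReal.eq_bot_iff_forall_lt y |>.2 fun t => ?_
  obtain ⟨m, hm⟩ := exists_int_lt t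
  exact (h m).trans_lt (EReal.coe_lt_coe_iff.2 hm)

theorem le_int_sub_infP {y : EReal}
    (h : ∀ c : ℤ, ((c : ℝ) : EReal) ≤ infP X → y ≤ (((n - c : ℤ) : ℝ) : EReal)) :
    y ≤ ((n : ℝ) : EReal) - infP X := by
  obtain hX | hX | ⟨c, hX⟩ := infP_eq_bot_or_top_or_int X
  · simp [hX]
  · have : y = ⊥ := eq_bot_of_forall_le_int fun m => by simpa [hX] using h (n - m)
    exact this ▸ bot_le
  · simpa [hX] using h c hX.ge

theorem le_int_add_supP {y : EReal}
    (h : ∀ s : ℤ, supP X ≤ ((s : ℝ) : EReal) → y ≤ (((n + s : ℤ) : ℝ) : EReal)) :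
    y ≤ ((n : ℝ) : EReal) + supP X := by
  obtain hX | hX | ⟨s, hX⟩ := supP_eq_bot_or_top_or_int X
  · have : y = ⊥ := eq_bot_of_forall_le_int fun m => by simpa [hX] using h (m - n)
    exact this ▸ bot_le
  · simp [hX]
  · simpa [hX] using h s hX.le

theorem pureExact_or_of_add_sub_lt {i : ℤ}
    (h : ((n : ℝ) : EReal) + supP Y - infP X < ((i : ℝ) : EReal)) :
    PureExact X ∨ PureExact Y ∨ ∃ c s : ℤ, infP X = ((c : ℝ) : EReal) ∧
      supP Y = ((s : ℝ) : EReal) ∧ n + s - c < i := by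
  obtain hX | hX | ⟨c, hX⟩ := infP_eq_bot_or_top_or_int X
  · obtain hY | hY | ⟨s, hY⟩ := supP_eq_bot_or_top_or_int Y
    · exact .inr (.inl (supP_eq_bot_iff.1 hY))
    · simp [hX, hY] at h
    · rw [hX, hY, ← EReal.coe_add, EReal.sub_bot (EReal.coe_ne_bot _)] at h
      exact absurd h not_top_lt
  · exact .inl (infP_eq_top_iff.1 hX)
  · obtain hY | hY | ⟨s, hY⟩ := supP_eq_bot_or_top_or_int Y
    · exact .inr (.inl (supP_eq_bot_iff.1 hY))
    · simp [hX, hY] at h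
    · rw [hX, hY, ← EReal.coe_add, ← EReal.coe_sub] at h
      exact .inr (.inr ⟨c, s, hX, hY, by exact_mod_cast h⟩)

theorem zero_le_infP_single₀ (M : ModuleCat.{u} R) : 0 ≤ infP (single₀ M) := by
  refine le_infP_iff.2 fun k hk => pureExactAt_of_isZero (isZero_single₀ M ?_)
  rintro rfl
  simp at hk

theorem supP_single₀_le_zero (M : ModuleCat.{u} R) : supP (single₀ M) ≤ 0 := by
  refine supP_le_iff.2 fun k hk => pureExactAt_of_isZero (isZero_single₀ M ?_)
  rintro rfl
  simp at hk

end ExtendedIntegers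

end PureDerived

end

open PureDerived in
theorem theorem4p7_general {R : Type u} [Ring R]
    {𝒳 𝒴 : ObjectProperty (CochainComplex (ModuleCat.{u} R) ℤ)}
    (h𝒳 : ∀ X, 𝒳 X → IsBoundedAbove X) (h𝒴 : ∀ Y, 𝒴 Y → IsBoundedBelow Y)
    (single_mem_𝒳 : ∀ M, 𝒳 (single₀ M)) (single_mem_𝒴 : ∀ M, 𝒴 (single₀ M)) (n : ℤ) :
    List.TFAE [
      pureGlobalDim R ≤ ((n : ℝ) : EReal),
      ∀ X, 𝒳 X → ppd X ≤ ((n : ℝ) : EReal) - infP X,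
      ∀ Y, 𝒴 Y → pid Y ≤ ((n : ℝ) : EReal) + supP Y,
      ∀ X Y, 𝒳 X → 𝒴 Y → ∀ (P : PureProjectiveResolution X) (i : ℤ),
        ((n : ℝ) : EReal) + supP Y - infP X < ((i : ℝ) : EReal) → IsZero (P.Pext Y i)] := by
  tfae_have 1 → 3 := fun h Y hY => le_int_add_supP fun s hs => pid_le_iff.2 <|
    hasPidLE_of_forall_single₀ (pureGlobalDim_le_iff.1 h) (h𝒴 Y hY) (supP_le_int_iff.1 hs)
  tfae_have 3 → 4 := by
    intro h X Y _ hY P i hi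
    refine homVanishes_iff_isZero.1 ?_
    obtain hX | hY' | ⟨c, s, hc, hs, hcs⟩ := pureExact_or_of_add_sub_lt hi
    · exact P.homVanishes_of_pureExact hX Y i
    · exact P.isKPureProjective.homVanishes hY' i
    · have hpid : HasPidLE Y (n + s) := pid_le_iff.1 (by simpa [hs] using h Y hY)
      exact hpid.homVanishes (int_le_infP_iff.1 hc.ge) P hcs
  tfae_have 4 → 2 := fun h X hX => le_int_sub_infP fun c hc => ppd_le_iff.2 <|
    hasPpdLE_of_homVanishes (h𝒳 X hX) fun P N k hk => homVanishes_iff_isZero.2 <|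
      h X _ hX (single_mem_𝒴 N) P k <| calc
        _ ≤ ((n : ℝ) : EReal) + 0 - ((c : ℝ) : EReal) :=
          EReal.sub_le_sub (add_le_add le_rfl (supP_single₀_le_zero N)) hc
        _ = (((n - c : ℤ) : ℝ) : EReal) := by simp
        _ < ((k : ℝ) : EReal) := by exact_mod_cast hk
  tfae_have 2 → 1 := fun h => pureGlobalDim_le_iff.2 fun M => ppd_le_iff.1 <|
    (h _ (single_mem_𝒳 M)).trans <|
      (EReal.sub_le_sub le_rfl (zero_le_infP_single₀ M)).trans_eq (sub_zero _)
  tfae_finish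

theorem theorem4p7 {R : Type u} [Ring R] (n : ℤ) :
    List.TFAE [
      PureDerived.pureGlobalDim R ≤ ((n : ℝ) : EReal),
      ∀ X : CochainComplex (ModuleCat.{u} R) ℤ, PureDerived.IsBounded X →
        PureDerived.ppd X ≤ ((n : ℝ) : EReal) - PureDerived.infP X,
      ∀ Y : CochainComplex (ModuleCat.{u} R) ℤ, PureDerived.IsBounded Y →
        PureDerived.pid Y ≤ ((n : ℝ) : EReal) + PureDerived.supP Y,
      ∀ X Y : CochainComplex (ModuleCat.{u} R) ℤ,
        PureDerived.IsBounded X → PureDerived.IsBounded Y →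
        ∀ (P : PureDerived.PureProjectiveResolution X) (i : ℤ),
          ((n : ℝ) : EReal) + PureDerived.supP Y - PureDerived.infP X < ((i : ℝ) : EReal) →
          CategoryTheory.Limits.IsZero (P.Pext Y i)] :=
  theorem4p7_general (fun _ => PureDerived.IsBounded.isBoundedAbove)
    (fun _ => PureDerived.IsBounded.isBoundedBelow) PureDerived.isBounded_single₀
    PureDerived.isBounded_single₀ n
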